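/- All spaces are Hausdorff, $I=[0,1]$, and $\Omega^n(Z,z)$ is the set of $n$-loops, i.e. continuous maps $f:I^n\to Z$ with $f(\partial I^n)\subseteq\{z\}$ (for $n=0$: points of $Z$). A sequence of maps $f_m:K\to Z$ \emph{converges to} $z\in Z$ if every neighborhood of $z$ contains the image of $f_m$ for all but finitely many $m$. Two sequences $\{f_m\},\{g_m\}$ of maps $K\to Z$ converging to $z$ are \emph{sequentially homotopic} (rel. $S\subseteq K$) if there are homotopies $H_m:K\times I\to Z$ from $f_m$ to $g_m$ (constant on $S$) such that $\{H_m\}$ converges to $z$. Let $\mathbb{H}_k$ be the $k$-dimensional Hawaiian earring: the one-point union of countably many $k$-spheres, with wedge point $b_0$, in which $U$ is open iff $U$ meets each sphere in an open set and, if $b_0\in U$, contains all but finitely many of the spheres. A space $Z$ is \emph{sequentially $n$-connected at} $z$ if the set $[(\mathbb{H}_k,b_0),(Z,z)]$ of pointed homotopy classes is trivial for all $0\le k\le n$. Let $X$ be a space, $\{x_j\}_{j\in\mathbb{N}}$ a sequence of (not necessarily distinct) points of $X$, and $\{(A_j,a_j)\}_{j\in\mathbb{N}}$ a sequence of based spaces.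 Let $Y_k$ be the adjunction space obtained from $X$ by attaching the first $k$ of the spaces $A_j$ along $a_j\sim x_j$, with the quotient topology. The \emph{shrinking adjunction space} $Y=\mathbf{Adj}(X,x_j,A_j,a_j)$ is the inverse limit of the spaces $Y_k$ under the retractions $Y_{k+1}\to Y_k$ that collapse the last attached space to its attachment point. View $X$ as a subspace of $Y$, and let $r:Y\to X$ be the canonical retraction, which collapses each $A_j$ to $x_j$. \textbf{Theorem.} Let $n\ge 0$, let $Y=\mathbf{Adj}(X,x_j,A_j,a_j)$ where each $A_j$ is sequentially $n$-connected at $a_j$, and let $y_0\in X$. \begin{enumerate} \item Every sequence $\{f_m\}_{m\in\mathbb{N}}$ in $\Omega^n(Y,y_0)$ that converges to $y_0$ is sequentially homotopic rel. $\partial I^n$ to $\{r\circ f_m\}_{m\in\mathbb{N}}$. \item If $X$ is sequentially $n$-connected at $y_0$, then $Y$ is sequentially $n$-connected at $y_0$. \item For all $0\le m\le n$ the map $r_\#:\pi_m(Y,y_0)\to\pi_m(X,y_0)$ induced by $r$ is an isomorphism (a bijection for $m=0$, an isomorphism of groups for $m\ge 1$). \end{enumerate} -/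

import Mathlib

open Filter Topology
open scoped unitInterval

noncomputable section

/-! ### Sequential homotopy -/

/-- A sequence of maps `f m : K → Y` converges to the point `y` if every neighbourhood of `y`
contains the image of `f m` for all but finitely many `m`. -/
def ConvergesToPoint {K Y : Type*} [TopologicalSpace K] [TopologicalSpace Y]
    (f : ℕ → C(K, Y)) (y : Y) : Prop :=
  ∀ U ∈ 𝓝 y, ∀ᶠ m in atTop, Set.range (f m) ⊆ U

/-- Two sequences of maps `K → Y` that converge to `y` are sequentially homotopic rel. `S` if there
are homotopies `H m : I × K → Y` from `f m` to `g m`, each constant on `S`, such that the sequence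
`H` converges to `y` as well. (For `S = ∅` these are free homotopies.) -/
def SequentiallyHomotopicRel {K Y : Type*} [TopologicalSpace K] [TopologicalSpace Y]
    (S : Set K) (f g : ℕ → C(K, Y)) (y : Y) : Prop :=
  ConvergesToPoint f y ∧ ConvergesToPoint g y ∧
    ∃ H : ∀ m : ℕ, ContinuousMap.HomotopyRel (f m) (g m) S,
      ConvergesToPoint (fun m => ((H m).toContinuousMap : C(I × K, Y))) y

/-! ### Pointed homotopy classes -/

/-- Based maps `(X, x) → (Y, y)`. -/
def BasedMap (X : Type*) [TopologicalSpace X] (x : X) (Y : Type*) [TopologicalSpace Y] (y : Y) :=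
  {f : C(X, Y) // f x = y}

/-- Homotopy of based maps through based maps. -/
def basedHomotopySetoid (X : Type*) [TopologicalSpace X] (x : X)
    (Y : Type*) [TopologicalSpace Y] (y : Y) : Setoid (BasedMap X x Y y) where
  r f g := ContinuousMap.HomotopicRel f.1 g.1 {x}
  iseqv := ⟨fun f => ContinuousMap.HomotopicRel.refl f.1, fun h => h.symm, fun h k => h.trans k⟩

/-- The set `[(X, x), (Y, y)]` of pointed homotopy classes of based maps. -/
def PointedHomotopyClasses (X : Type*) [TopologicalSpace X] (x : X)
    (Y : Type*) [TopologicalSpace Y] (y : Y) :=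
  Quotient (basedHomotopySetoid X x Y y)

/-! ### Shrinking wedges and Hawaiian earrings -/

/-- The relation identifying all base points in a disjoint union. -/
inductive WedgeRel (A : ℕ → Type*) (a : ∀ j, A j) : (Σ j, A j) → (Σ j, A j) → Prop
  | glue (i j : ℕ) : WedgeRel A a ⟨i, a i⟩ ⟨j, a j⟩

/-- The underlying set of the shrinking wedge of a sequence of based spaces: the one-point union. -/
def ShrinkingWedge (A : ℕ → Type*) (a : ∀ j, A j) := Quot (WedgeRel A a)

namespace ShrinkingWedge

/-- The canonical map from the `j`-th wedge summand. -/
def incl (A : ℕ → Type*) (a : ∀ j, A j) (j : ℕ) (p : A j) : ShrinkingWedge A a :=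
  Quot.mk (WedgeRel A a) ⟨j, p⟩

/-- The wedge point. -/
def base (A : ℕ → Type*) (a : ∀ j, A j) : ShrinkingWedge A a := incl A a 0 (a 0)

/-- `U` is open iff it meets every summand in an open set and, if it contains the wedge point,
contains all but finitely many summands. -/
instance instTopologicalSpace (A : ℕ → Type*) [∀ j, TopologicalSpace (A j)] (a : ∀ j, A j) :
    TopologicalSpace (ShrinkingWedge A a) where
  IsOpen U := (∀ j, IsOpen (incl A a j ⁻¹' U)) ∧
    (base A a ∈ U → {j | ¬ Set.range (incl A a j) ⊆ U}.Finite)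
  isOpen_univ := ⟨fun j => by simp, fun _ => by simp⟩
  isOpen_inter U V hU hV := by
    refine ⟨fun j => (hU.1 j).inter (hV.1 j), fun h => ?_⟩
    refine ((hU.2 h.1).union (hV.2 h.2)).subset fun j hj => ?_
    by_contra hcon
    simp only [Set.mem_union, Set.mem_ofPred_eq, not_or, not_not] at hcon
    exact hj (Set.subset_inter hcon.1 hcon.2)
  isOpen_sUnion S hS := by
    refine ⟨fun j => ?_, ?_⟩
    · rw [Set.preimage_sUnion]
      exact isOpen_biUnion fun U hU => (hS U hU).1 j
    · rintro ⟨U, hU, hb⟩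
      exact ((hS U hU).2 hb).subset fun j hj hjU => hj (hjU.trans (Set.subset_sUnion_of_mem hU))

end ShrinkingWedge

/-- The unit sphere `S^n` in `ℝ^(n+1)`. -/
abbrev UnitSphere (n : ℕ) : Type := Metric.sphere (0 : EuclideanSpace ℝ (Fin (n + 1))) 1

/-- The base point `(1, 0, …, 0)` of `S^n`. -/
def UnitSphere.base (n : ℕ) : UnitSphere n :=
  ⟨EuclideanSpace.single 0 1, by simp⟩

/-- The `n`-dimensional Hawaiian earring: the shrinking wedge of countably many `n`-spheres. -/
abbrev HawaiianEarring (n : ℕ) : Type :=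
  ShrinkingWedge (fun _ : ℕ => UnitSphere n) (fun _ => UnitSphere.base n)

/-- The wedge point of the `n`-dimensional Hawaiian earring. -/
abbrev HawaiianEarring.base (n : ℕ) : HawaiianEarring n :=
  ShrinkingWedge.base (fun _ : ℕ => UnitSphere n) (fun _ => UnitSphere.base n)

/-- `X` is sequentially `n`-connected at `x` if `[(ℍ_k, b₀), (X, x)]` is trivial for `0 ≤ k ≤ n`.
(This set always contains the class of the constant map.) -/
def SequentiallyConnectedAt (n : ℕ) (X : Type*) [TopologicalSpace X] (x : X) : Prop :=
  ∀ k ≤ n, Subsingleton (PointedHomotopyClasses (HawaiianEarring k) (HawaiianEarring.base k) X x)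

/-! ### Shrinking adjunction spaces -/

/-- The relation identifying `a j` with `x j` for `j < k`. -/
inductive AdjRel {X : Type*} (x : ℕ → X) (A : ℕ → Type*) (a : ∀ j, A j) (k : ℕ) :
    (X ⊕ Σ j : Fin k, A j) → (X ⊕ Σ j : Fin k, A j) → Prop
  | glue (j : Fin k) : AdjRel x A a k (Sum.inl (x j)) (Sum.inr ⟨j, a j⟩)

/-- The ordinary adjunction space obtained from `X` by attaching `A j` along `a j ∼ x j` for
`j < k`, with the quotient topology. -/
abbrev FiniteAdj {X : Type*} (x : ℕ → X) (A : ℕ → Type*) (a : ∀ j, A j) (k : ℕ) :=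
  Quot (AdjRel x A a k)

namespace FiniteAdj

/-- The retraction that collapses the last attached space to its attachment point and is the
identity elsewhere. -/
def collapse {X : Type*} (x : ℕ → X) (A : ℕ → Type*) (a : ∀ j, A j) (k : ℕ) :
    FiniteAdj x A a (k + 1) → FiniteAdj x A a k :=
  Quot.lift
    (Sum.elim (fun p => Quot.mk _ (Sum.inl p))
      (fun q => if h : (q.1 : ℕ) < k then Quot.mk _ (Sum.inr ⟨⟨q.1, h⟩, q.2⟩)
        else Quot.mk _ (Sum.inl (x q.1))))
    (by
      rintro _ _ ⟨j⟩
      by_cases h : (j : ℕ) < k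
      · simpa [h] using Quot.sound (AdjRel.glue (x := x) (a := a) (⟨j, h⟩ : Fin k))
      · simp [h])

/-- The retraction onto `X` that collapses every attached space to its attachment point. -/
def toCore {X : Type*} [TopologicalSpace X] (x : ℕ → X) (A : ℕ → Type*)
    [∀ j, TopologicalSpace (A j)] (a : ∀ j, A j) (k : ℕ) : C(FiniteAdj x A a k, X) where
  toFun := Quot.lift (Sum.elim id (fun q => x q.1)) (by rintro _ _ ⟨j⟩; rfl)
  continuous_toFun := by
    refine continuous_quot_lift _ ?_
    exact continuous_id.sumElim (continuous_sigma fun j => (continuous_const : Continuous fun _ : A j => x j))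

end FiniteAdj

/-- The shrinking adjunction space `Adj(X, x_j, A_j, a_j)`: the inverse limit of the ordinary
adjunction spaces under the collapsing retractions, as a subspace of the direct product. -/
abbrev ShrinkingAdj {X : Type*} (x : ℕ → X) (A : ℕ → Type*) (a : ∀ j, A j) :=
  {y : ∀ k, FiniteAdj x A a k // ∀ k, FiniteAdj.collapse x A a k (y (k + 1)) = y k}

namespace ShrinkingAdj

/-- The inclusion of the core `X`. -/
def core {X : Type*} [TopologicalSpace X] (x : ℕ → X) (A : ℕ → Type*)
    [∀ j, TopologicalSpace (A j)] (a : ∀ j, A j) : C(X, ShrinkingAdj x A a) where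
  toFun p := ⟨fun _ => Quot.mk _ (Sum.inl p), fun _ => rfl⟩
  continuous_toFun := Continuous.subtype_mk
    (continuous_pi fun _ => continuous_quot_mk.comp continuous_inl) _

/-- The `k`-th projection followed by the retraction onto `X` does not depend on `k`. -/
theorem toCore_eq {X : Type*} [TopologicalSpace X] (x : ℕ → X) (A : ℕ → Type*)
    [∀ j, TopologicalSpace (A j)] (a : ∀ j, A j) (y : ShrinkingAdj x A a) (k : ℕ) :
    FiniteAdj.toCore x A a k (y.1 k) = FiniteAdj.toCore x A a 0 (y.1 0) := by
  induction k with
  | zero => rfl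
  | succ k ih =>
    rw [← ih, ← y.2 k]
    generalize y.1 (k + 1) = z
    obtain ⟨p | ⟨j, p⟩⟩ := z
    · rfl
    · by_cases h : (j : ℕ) < k <;> simp [FiniteAdj.collapse, FiniteAdj.toCore, h]

/-- The canonical retraction `r` onto the core, collapsing every `A j` to `x j`. -/
def retraction {X : Type*} [TopologicalSpace X] (x : ℕ → X) (A : ℕ → Type*)
    [∀ j, TopologicalSpace (A j)] (a : ∀ j, A j) : C(ShrinkingAdj x A a, X) where
  toFun y := FiniteAdj.toCore x A a 0 (y.1 0)
  continuous_toFun := (FiniteAdj.toCore x A a 0).continuous.comp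
    ((continuous_apply 0).comp continuous_subtype_val)

theorem retraction_core {X : Type*} [TopologicalSpace X] (x : ℕ → X) (A : ℕ → Type*)
    [∀ j, TopologicalSpace (A j)] (a : ∀ j, A j) (p : X) :
    retraction x A a (core x A a p) = p := rfl

end ShrinkingAdj

/-! ### Induced maps on homotopy groups -/

/-- The `n`-loop `h ∘ f`. -/
def GenLoop.postcomp {N X Y : Type*} [TopologicalSpace X] [TopologicalSpace Y] {x : X} {y : Y}
    (h : C(X, Y)) (hxy : h x = y) (f : GenLoop N X x) : GenLoop N Y y :=
  ⟨h.comp f.1, fun t ht => by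
    rw [ContinuousMap.comp_apply, f.2 t ht, hxy]⟩

/-- The map `π_m(X, x) → π_m(Y, y)`, `[f] ↦ [h ∘ f]`, induced by a based map `h`. -/
def HomotopyGroup.induced {X Y : Type*} [TopologicalSpace X] [TopologicalSpace Y] {x : X} {y : Y}
    (h : C(X, Y)) (hxy : h x = y) (m : ℕ) : HomotopyGroup.Pi m X x → HomotopyGroup.Pi m Y y :=
  Quotient.map (GenLoop.postcomp h hxy) (fun _ _ hfg => ContinuousMap.HomotopicRel.comp_continuousMap hfg h)

end

/-!
A point of `Y` is determined by its image `r y` in `X` together with its images in the spaces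
`A_j`, all but at most one of which are the base point, and the topology of `Y` is that of
coordinatewise convergence. A sequence of loops converging to `y₀` can therefore be deformed into
`X` one coordinate at a time: if every coordinate sequence `g_m : ℝⁿ → A_j` is contracted to
`a_j` through a sequence of homotopies that again converges to `a_j` and fixes every point of
`g_m ⁻¹ {a_j}`, then the contracted coordinates are at all times the coordinates of a point of
`Y`.

Such a contraction is built on the open set `U = {g ≠ a_j}` alone. As in a Whitney decomposition,
`U` is a locally finite union of dyadic cubes that shrink towards the boundary of `U`, and the
contraction is constructed on the faces of these cubes, by induction on their dimension:
extending it over the cylinder on a `k`-dimensional face means filling in a `k`-sphere.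
Enumerating the faces gives a sequence of `k`-spheres that converges to `a_j`, and sequential
`k`-connectedness of `A_j` fills these spheres in by a sequence that converges to `a_j` as well.
Hence the contraction extends continuously by `a_j` outside `U`.
-/

noncomputable section

/-! ### Sequences of maps converging to a point -/

section Convergence

variable {K S T Y Z : Type*} [TopologicalSpace K] [TopologicalSpace S] [TopologicalSpace T]
  [TopologicalSpace Y] [TopologicalSpace Z]

theorem convergesToPoint_iff_eventually {f : ℕ → C(K, Y)} {y : Y} :
    ConvergesToPoint f y ↔ ∀ U ∈ 𝓝 y, ∀ᶠ m in atTop, ∀ p, f m p ∈ U := by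
  simp only [ConvergesToPoint, Set.range_subset_iff]

theorem convergesToPoint_iff_tendsto {f : ℕ → C(K, Y)} {y : Y} :
    ConvergesToPoint f y ↔ Tendsto (fun q : ℕ × K => f q.1 q.2) (atTop ×ˢ ⊤) (𝓝 y) := by
  rw [convergesToPoint_iff_eventually, tendsto_def]
  simp only [mem_prod_top, Set.mem_preimage, Filter.Eventually]

theorem convergesToPoint_iff_tendsto_cocompact [CompactSpace K] {f : ℕ → C(K, Y)} {y : Y} :
    ConvergesToPoint f y ↔ Tendsto (fun q : ℕ × K => f q.1 q.2) (cocompact (ℕ × K)) (𝓝 y) := by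
  rw [convergesToPoint_iff_tendsto, ← coprod_cocompact, cocompact_eq_atTop (α := ℕ),
    cocompact_eq_bot, coprod_bot, prod_top]

theorem ConvergesToPoint.postcomp {f : ℕ → C(K, Y)} {y : Y} (hf : ConvergesToPoint f y)
    (h : C(Y, Z)) : ConvergesToPoint (fun m => h.comp (f m)) (h y) :=
  convergesToPoint_iff_tendsto.2 ((h.continuous.tendsto y).comp (convergesToPoint_iff_tendsto.1 hf))

theorem ConvergesToPoint.precomp {f : ℕ → C(K, Y)} {y : Y} (hf : ConvergesToPoint f y)
    (φ : C(T, K)) : ConvergesToPoint (fun m => (f m).comp φ) y :=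
  fun U hU => (hf U hU).mono fun m hm => (Set.range_comp_subset_range φ (f m)).trans hm

theorem convergesToPoint_curry_iff [CompactSpace T] {h : ℕ → C(T × S, Z)} {z : Z} :
    ConvergesToPoint (fun m => ((h m).comp ContinuousMap.prodSwap).curry)
      (ContinuousMap.const T z) ↔ ConvergesToPoint h z := by
  rw [convergesToPoint_iff_tendsto, ContinuousMap.tendsto_nhds_compactOpen,
    convergesToPoint_iff_eventually]
  constructor
  · intro hh U hU
    obtain ⟨V, hVU, hV, hz⟩ := mem_nhds_iff.1 hU
    filter_upwards [mem_prod_top.1 (hh _ isCompact_univ V hV fun _ _ => hz)] with m hm p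
    exact hVU (hm p.2 (Set.mem_univ p.1))
  · intro hh L _ U hU hLU
    obtain rfl | ⟨t, ht⟩ := L.eq_empty_or_nonempty
    · exact Eventually.of_forall fun _ => Set.mapsTo_empty _ _
    · refine mem_prod_top.2 ?_
      filter_upwards [hh U (hU.mem_nhds (hLU ht))] with m hm p t _ using hm (t, p)

end Convergence

section SequentiallyHomotopicRel

variable {K Y Z : Type*} [TopologicalSpace K] [TopologicalSpace Y] [TopologicalSpace Z]
  {S : Set K} {f g h : ℕ → C(K, Y)} {y : Y}

theorem SequentiallyHomotopicRel.homotopicRel (hfg : SequentiallyHomotopicRel S f g y) (m : ℕ) :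
    (f m).HomotopicRel (g m) S :=
  let ⟨_, _, H, _⟩ := hfg
  ⟨H m⟩

theorem SequentiallyHomotopicRel.postcomp (hfg : SequentiallyHomotopicRel S f g y) (φ : C(Y, Z)) :
    SequentiallyHomotopicRel S (fun m => φ.comp (f m)) (fun m => φ.comp (g m)) (φ y) :=
  let ⟨hf, hg, H, hH⟩ := hfg
  ⟨hf.postcomp φ, hg.postcomp φ, fun m => (H m).compContinuousMap φ, hH.postcomp φ⟩

theorem SequentiallyHomotopicRel.trans (hfg : SequentiallyHomotopicRel S f g y)
    (hgh : SequentiallyHomotopicRel S g h y) : SequentiallyHomotopicRel S f h y := by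
  obtain ⟨hf, -, H, hH⟩ := hfg
  obtain ⟨-, hh, H', hH'⟩ := hgh
  refine ⟨hf, hh, fun m => (H m).trans (H' m), convergesToPoint_iff_eventually.2 fun U hU => ?_⟩
  filter_upwards [convergesToPoint_iff_eventually.1 hH U hU,
    convergesToPoint_iff_eventually.1 hH' U hU] with m hm hm' p
  change (H m).trans (H' m) p ∈ U
  rw [ContinuousMap.HomotopyRel.trans_apply]
  split_ifs
  exacts [hm _, hm' _]

end SequentiallyHomotopicRel

/-! ### Maps out of shrinking wedges -/

namespace ShrinkingWedge

section

variable (A : ℕ → Type*) (a : ∀ j, A j)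

theorem incl_basepoint (j : ℕ) : incl A a j (a j) = base A a :=
  Quot.sound (WedgeRel.glue j 0)

variable [∀ j, TopologicalSpace (A j)]

/-- The inclusion of the `j`-th wedge summand as a continuous map. -/
def inclMap (j : ℕ) : C(A j, ShrinkingWedge A a) where
  toFun := incl A a j
  continuous_toFun := ⟨fun _ hU => hU.1 j⟩

variable {A a}

theorem eventually_forall_of_eventually_nhds_base {p : ShrinkingWedge A a → Prop}
    (h : ∀ᶠ q in 𝓝 (base A a), p q) : ∀ᶠ j in atTop, ∀ t, p (inclMap A a j t) := by
  obtain ⟨U, hU, hUo, hb⟩ := eventually_nhds_iff.1 h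
  rw [← Nat.cofinite_eq_atTop]
  exact (hUo.2 hb).subset fun j hj hsub => hj fun t => hU _ (hsub ⟨t, rfl⟩)

end

variable {S Z : Type*} [TopologicalSpace S] [TopologicalSpace Z] {s : S} {z : Z}

/-- The map on a shrinking wedge of copies of `S` defined by a sequence of based maps that converges
to the base point. -/
def lift (g : ℕ → C(S, Z)) (hs : ∀ m, g m s = z) (hg : ConvergesToPoint g z) :
    C(ShrinkingWedge (fun _ : ℕ => S) (fun _ => s), Z) where
  toFun := Quot.lift (fun q => g q.1 q.2) (by rintro _ _ ⟨i, j⟩; exact (hs i).trans (hs j).symm)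
  continuous_toFun := by
    refine ⟨fun U hU => ⟨fun j => hU.preimage (g j).continuous, fun hb => ?_⟩⟩
    have hz : z ∈ U := hs 0 ▸ hb
    have hev := convergesToPoint_iff_eventually.1 hg U (hU.mem_nhds hz)
    rw [← Nat.cofinite_eq_atTop] at hev
    exact hev.subset fun j hj hall => hj (Set.range_subset_iff.2 hall)

theorem convergesToPoint_comp_inclMap (F : C(ShrinkingWedge (fun _ : ℕ => S) (fun _ => s), Z))
    (hF : F (base _ _) = z) :
    ConvergesToPoint (fun m => F.comp (inclMap (fun _ => S) (fun _ => s) m)) z :=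
  convergesToPoint_iff_eventually.2 fun _ hU =>
    eventually_forall_of_eventually_nhds_base (F.continuous.continuousAt (hF.symm ▸ hU))

/-- Both directions regard a homotopy as a map into the path space `C(I, Z)`, to which `lift` and
`convergesToPoint_comp_inclMap` apply. -/
theorem homotopicRel_iff {F G : C(ShrinkingWedge (fun _ : ℕ => S) (fun _ => s), Z)}
    (hF : F (base _ _) = z) :
    F.HomotopicRel G {base _ _} ↔
      SequentiallyHomotopicRel {s} (fun m => F.comp (inclMap (fun _ => S) (fun _ => s) m))
        (fun m => G.comp (inclMap (fun _ => S) (fun _ => s) m)) z := by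
  constructor
  · rintro ⟨H⟩
    have hHb : ∀ t, H (t, base _ _) = z := fun t => (H.eq_fst t rfl).trans hF
    have hG : G (base _ _) = z := (H.apply_one (base _ _)).symm.trans (hHb 1)
    have hbase : ∀ m, inclMap (fun _ => S) (fun _ => s) m s = base _ _ :=
      incl_basepoint (fun _ => S) fun _ => s
    let L := (H.toContinuousMap.comp ContinuousMap.prodSwap).curry
    have hL : L (base _ _) = ContinuousMap.const I z := ContinuousMap.ext hHb
    exact ⟨convergesToPoint_comp_inclMap F hF, convergesToPoint_comp_inclMap G hG,
      fun m =>
        { toContinuousMap := H.toContinuousMap.comp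
            ((ContinuousMap.id I).prodMap (inclMap (fun _ => S) (fun _ => s) m))
          map_zero_left := fun p => H.apply_zero _
          map_one_left := fun p => H.apply_one _
          prop' := fun t p hp => H.eq_fst t ((congrArg _ hp).trans (hbase m)) },
      convergesToPoint_curry_iff.1 (convergesToPoint_comp_inclMap L hL)⟩
  · rintro ⟨-, -, H, hH⟩
    have hs : ∀ m t, H m (t, s) = z := fun m t =>
      ((H m).eq_fst t rfl).trans ((congrArg F (incl_basepoint (fun _ => S) _ m)).trans hF)
    let L := lift (s := s) (z := ContinuousMap.const I z)
      (fun m => ((H m).toContinuousMap.comp ContinuousMap.prodSwap).curry)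
      (fun m => ContinuousMap.ext (hs m)) (convergesToPoint_curry_iff.2 hH)
    refine ⟨⟨⟨L.uncurry.comp ContinuousMap.prodSwap, ?_, ?_⟩, ?_⟩⟩
    · rintro ⟨m, p⟩
      exact (H m).apply_zero p
    · rintro ⟨m, p⟩
      exact (H m).apply_one p
    · rintro t _ rfl
      exact (hs 0 t).trans hF.symm

end ShrinkingWedge

/-! ### Sequential connectedness in terms of sequences of spheres -/

section SequentiallyConnectedAt

variable {n k : ℕ} {A : Type*} [TopologicalSpace A] {a : A}

theorem SequentiallyConnectedAt.mono (h : SequentiallyConnectedAt n A a) (hk : k ≤ n) :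
    SequentiallyConnectedAt k A a :=
  fun l hl => h l (hl.trans hk)

theorem sequentiallyConnectedAt_iff :
    SequentiallyConnectedAt n A a ↔
      ∀ k ≤ n, ∀ g : ℕ → C(UnitSphere k, A), (∀ m, g m (UnitSphere.base k) = a) →
        ConvergesToPoint g a →
        SequentiallyHomotopicRel {UnitSphere.base k} g (fun _ => ContinuousMap.const _ a) a := by
  refine forall₂_congr fun k _ => ⟨fun h g hb hg => ?_, fun h => ⟨fun p q => ?_⟩⟩
  · have : Subsingleton (Quotient (basedHomotopySetoid (HawaiianEarring k) (HawaiianEarring.base k)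
      A a)) := h
    refine (ShrinkingWedge.homotopicRel_iff (F := ShrinkingWedge.lift g hb hg)
      (G := ContinuousMap.const _ a) (hb 0)).1 ?_
    exact Quotient.exact (Subsingleton.elim
      (Quotient.mk (basedHomotopySetoid _ (HawaiianEarring.base k) A a) ⟨_, hb 0⟩)
      (Quotient.mk _ ⟨ContinuousMap.const _ a, rfl⟩))
  · have hnull : ∀ F : BasedMap (HawaiianEarring k) (HawaiianEarring.base k) A a,
        F.1.HomotopicRel (ContinuousMap.const _ a) {HawaiianEarring.base k} := fun F =>
      (ShrinkingWedge.homotopicRel_iff F.2).2 <| h _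
        (fun m => (congrArg F.1 (ShrinkingWedge.incl_basepoint _ _ m)).trans F.2)
        (ShrinkingWedge.convergesToPoint_comp_inclMap F.1 F.2)
    induction p, q using Quotient.inductionOn₂ with
    | h p q => exact Quotient.sound ((hnull p).trans (hnull q).symm)

end SequentiallyConnectedAt

/-! ### Filling spheres in normed spaces -/

section RadialProjection

variable {W : Type*} [NormedAddCommGroup W] [NormedSpace ℝ W] {k : ℕ}
  (L : W ≃L[ℝ] EuclideanSpace ℝ (Fin (k + 1)))

/-- The radial projection of a normed space onto the Euclidean unit sphere along a linear
equivalence. The value at the origin is arbitrary. -/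
def radialProj (w : W) : UnitSphere k :=
  open Classical in
  if h : w = 0 then UnitSphere.base k
  else ⟨‖L w‖⁻¹ • L w, by
    have : L w ≠ 0 := by simpa using h
    simp [norm_smul, this]⟩

theorem coe_radialProj {w : W} (h : w ≠ 0) :
    (radialProj L w : EuclideanSpace ℝ (Fin (k + 1))) = ‖L w‖⁻¹ • L w := by
  simp [radialProj, h]

theorem continuousAt_radialProj {w : W} (h : w ≠ 0) : ContinuousAt (radialProj L) w := by
  rw [IsInducing.subtypeVal.continuousAt_iff]
  have hquot : ContinuousAt (fun w => ‖L w‖⁻¹ • L w) w := by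
    have : ‖L w‖ ≠ 0 := by simpa using h
    fun_prop (disch := assumption)
  refine hquot.congr ?_
  filter_upwards [isOpen_ne.mem_nhds h] with v hv using (coe_radialProj L hv).symm

/-- The homeomorphism from the Euclidean unit sphere onto the unit sphere of `W` that is inverse to
the radial projection. -/
def radialSection (p : UnitSphere k) : W := ‖L.symm p‖⁻¹ • L.symm p

theorem continuous_radialSection : Continuous (radialSection L) := by
  have : ∀ p : UnitSphere k, ‖L.symm (p : EuclideanSpace ℝ (Fin (k + 1)))‖ ≠ 0 := fun p => by
    simpa using ne_zero_of_mem_unit_sphere p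
  unfold radialSection
  fun_prop (disch := assumption)

theorem norm_radialSection (p : UnitSphere k) : ‖radialSection L p‖ = 1 := by
  have : L.symm (p : EuclideanSpace ℝ (Fin (k + 1))) ≠ 0 := by
    simpa using ne_zero_of_mem_unit_sphere p
  simp [radialSection, norm_smul, this]

theorem radialSection_radialProj {w : W} (h : ‖w‖ = 1) :
    radialSection L (radialProj L w) = w := by
  have h0 : w ≠ 0 := norm_ne_zero_iff.1 (h ▸ one_ne_zero)
  have hL : ‖L w‖ ≠ 0 := by simpa using h0
  simp [radialSection, coe_radialProj L h0, norm_smul, smul_smul, h, hL]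

variable {A : Type*} [TopologicalSpace A] {a : A}

/-- The extension to `W` of a map of spheres with a nullhomotopy `H`: the point at radius `r ≤ 1` in
direction `p` goes to `H (1 - r, p)`. -/
def coneMap (H : C(I × UnitSphere k, A)) (w : W) : A :=
  H (Set.projIcc 0 1 zero_le_one (1 - ‖w‖), radialProj L w)

theorem continuous_coneMap {H : C(I × UnitSphere k, A)} (hH : ∀ p, H (1, p) = a) :
    Continuous (coneMap L H) := by
  have hτ : Continuous fun w : W => Set.projIcc (0 : ℝ) 1 zero_le_one (1 - ‖w‖) := by fun_prop
  rw [continuous_iff_continuousAt]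
  intro w
  by_cases hw : w = 0
  · intro U hU
    have hτ0 : Set.projIcc (0 : ℝ) 1 zero_le_one (1 - ‖w‖) = 1 := by simp [hw]
    rw [coneMap, hτ0, hH] at hU
    have hev : ∀ᶠ t in 𝓝 (1 : I), ∀ p ∈ (Set.univ : Set (UnitSphere k)), H (t, p) ∈ U :=
      isCompact_univ.eventually_forall_of_forall_eventually fun p _ =>
        H.continuous.continuousAt (x := (1, p)) (by rwa [hH])
    rw [← hτ0] at hev
    exact (hτ.continuousAt.eventually hev).mono fun v hv => hv _ trivial
  · exact H.continuous.continuousAt.comp (hτ.continuousAt.prodMk (continuousAt_radialProj L hw))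

theorem coneMap_of_norm_eq_one (H : C(I × UnitSphere k, A)) {w : W} (hw : ‖w‖ = 1) :
    coneMap L H w = H (0, radialProj L w) := by
  simp [coneMap, hw]

end RadialProjection

section SequentiallyConnectedAt

variable {n k : ℕ} {A : Type*} [TopologicalSpace A] {a : A} {ι : Type*} [Countable ι]

theorem SequentiallyConnectedAt.exists_nullhomotopy_of_countable
    (h : SequentiallyConnectedAt n A a) (hk : k ≤ n) (g : ι → C(UnitSphere k, A))
    (hb : ∀ i, g i (UnitSphere.base k) = a) (hg : ∀ U ∈ 𝓝 a, ∀ᶠ i in cofinite, ∀ p, g i p ∈ U) :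
    ∃ H : ι → C(I × UnitSphere k, A), (∀ i p, H i (0, p) = g i p) ∧ (∀ i p, H i (1, p) = a) ∧
      ∀ U ∈ 𝓝 a, ∀ᶠ i in cofinite, ∀ w, H i w ∈ U := by
  obtain ⟨e, he⟩ := exists_injective_nat ι
  let g' : ℕ → C(UnitSphere k, A) := Function.extend e g fun _ => ContinuousMap.const _ a
  have hext : ∀ m, (∃ i, e i = m ∧ g' m = g i) ∨ g' m = ContinuousMap.const _ a := fun m => by
    by_cases hm : ∃ i, e i = m
    · obtain ⟨i, rfl⟩ := hm
      exact Or.inl ⟨i, rfl, he.extend_apply _ _ i⟩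
    · exact Or.inr (Function.extend_apply' _ _ _ hm)
  have hb' : ∀ m, g' m (UnitSphere.base k) = a := fun m => by
    obtain ⟨i, -, hi⟩ | hm := hext m
    exacts [hi ▸ hb i, hm ▸ rfl]
  have hg' : ConvergesToPoint g' a := convergesToPoint_iff_eventually.2 fun U hU => by
    rw [← Nat.cofinite_eq_atTop]
    refine ((hg U hU).image e).subset fun m hm => ?_
    obtain ⟨i, rfl, hi⟩ | hm' := hext m
    · exact ⟨i, fun hiU => hm fun p => hi ▸ hiU p, rfl⟩
    · exact absurd (fun _ => hm' ▸ mem_of_mem_nhds hU) hm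
  obtain ⟨-, -, H, hH⟩ := sequentiallyConnectedAt_iff.1 h k hk g' hb' hg'
  refine ⟨fun i => (H (e i)).toContinuousMap, fun i p => ?_, fun i p => (H (e i)).apply_one p,
    fun U hU => ?_⟩
  · exact ((H (e i)).apply_zero p).trans (DFunLike.congr_fun (he.extend_apply g _ i) p)
  · have hev := convergesToPoint_iff_eventually.1 hH U hU
    rw [← Nat.cofinite_eq_atTop] at hev
    exact he.tendsto_cofinite.eventually hev

theorem SequentiallyConnectedAt.exists_extension_of_sphere (h : SequentiallyConnectedAt n A a)
    (hk : k ≤ n) {W : ι → Type*} [∀ i, NormedAddCommGroup (W i)] [∀ i, NormedSpace ℝ (W i)]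
    (L : ∀ i, W i ≃L[ℝ] EuclideanSpace ℝ (Fin (k + 1))) {φ : ∀ i, W i → A}
    (hc : ∀ i, ContinuousOn (φ i) (Metric.sphere 0 1))
    (ha : ∀ i, φ i (radialSection (L i) (UnitSphere.base k)) = a)
    (hφ : ∀ U ∈ 𝓝 a, ∀ᶠ i in cofinite, ∀ w ∈ Metric.sphere 0 1, φ i w ∈ U) :
    ∃ Φ : ∀ i, W i → A, (∀ i, Continuous (Φ i)) ∧
      (∀ i, Set.EqOn (Φ i) (φ i) (Metric.sphere 0 1)) ∧
      ∀ U ∈ 𝓝 a, ∀ᶠ i in cofinite, ∀ w, Φ i w ∈ U := by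
  have hsec : ∀ i p, radialSection (L i) p ∈ Metric.sphere (0 : W i) 1 := fun i p => by
    simpa using norm_radialSection (L i) p
  obtain ⟨H, H0, H1, Hc⟩ := h.exists_nullhomotopy_of_countable hk
    (fun i => ⟨fun p => φ i (radialSection (L i) p),
      (hc i).comp_continuous (continuous_radialSection (L i)) (hsec i)⟩) ha
    (fun U hU => (hφ U hU).mono fun i hi p => hi _ (hsec i p))
  refine ⟨fun i => coneMap (L i) (H i), fun i => continuous_coneMap (L i) (H1 i), fun i w hw => ?_,
    fun U hU => (Hc U hU).mono fun i hi w => hi _⟩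
  rw [mem_sphere_zero_iff_norm] at hw
  refine (coneMap_of_norm_eq_one _ _ hw).trans ((H0 i _).trans ?_)
  exact congrArg (φ i) (radialSection_radialProj (L i) hw)

end SequentiallyConnectedAt

section Cylinder

variable {J : Type*} [Fintype J] {k : ℕ}

/-- The cylinder over `ℝ^J` as a Euclidean space, with the cylinder axis as first coordinate. -/
def cylinderEquivEuclidean (hJ : Fintype.card J = k) :
    (ℝ × (J → ℝ)) ≃L[ℝ] EuclideanSpace ℝ (Fin (k + 1)) :=
  (((ContinuousLinearEquiv.refl ℝ ℝ).prodCongr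
    (LinearEquiv.funCongrLeft ℝ ℝ (Fintype.equivFinOfCardEq hJ).symm).toContinuousLinearEquiv).trans
    (Fin.consEquivL ℝ fun _ : Fin (k + 1) => ℝ)).trans
    (EuclideanSpace.equiv (Fin (k + 1)) ℝ).symm

theorem cylinderEquivEuclidean_axis (hJ : Fintype.card J = k) :
    cylinderEquivEuclidean hJ (1, 0) = EuclideanSpace.single 0 1 := by
  ext i
  refine Fin.cases ?_ (fun i => ?_) i <;> simp [cylinderEquivEuclidean]

theorem radialSection_cylinderEquivEuclidean_base (hJ : Fintype.card J = k) :
    radialSection (cylinderEquivEuclidean hJ) (UnitSphere.base k) = (1, 0) := by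
  have hsymm : (cylinderEquivEuclidean hJ).symm (UnitSphere.base k).1 = (1, 0) :=
    (ContinuousLinearEquiv.symm_apply_eq _).2 (cylinderEquivEuclidean_axis hJ).symm
  simp [radialSection, hsymm, Prod.norm_def]

end Cylinder

/-! ### Dyadic faces -/

/-- Countably many copies of `ℝⁿ`. A map on `Sheets n` is a sequence of maps on `ℝⁿ`, so a single
cell decomposition of an open subset treats a whole sequence of open subsets of `ℝⁿ` at once. -/
abbrev Sheets (n : ℕ) : Type := ℕ × (Fin n → ℝ)

/-- A face of the dyadic grids of `Sheets n`: the product of the intervals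
`[lo i / 2 ^ level, hi i / 2 ^ level]` in the copy of `ℝⁿ` with index `sheet`. -/
@[ext]
structure DyadicFace (n : ℕ) where
  sheet : ℕ
  level : ℕ
  lo : Fin n → ℤ
  hi : Fin n → ℤ

namespace DyadicFace

variable {n : ℕ}

/-- The tuple of data defining a face. -/
def toTuple (F : DyadicFace n) : ℕ × ℕ × (Fin n → ℤ) × (Fin n → ℤ) :=
  (F.sheet, F.level, F.lo, F.hi)

theorem toTuple_injective : Function.Injective (toTuple (n := n)) := fun F G h => by
  simpa [toTuple, DyadicFace.ext_iff] using h

instance : Countable (DyadicFace n) :=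
  toTuple_injective.countable

/-- The closed face as a set of points. -/
def carrier (F : DyadicFace n) : Set (Sheets n) :=
  {z | z.1 = F.sheet ∧ ∀ i, F.lo i ≤ 2 ^ F.level * z.2 i ∧ 2 ^ F.level * z.2 i ≤ F.hi i}

/-- The union of the closed cubes of the same level that contain the face. -/
def star (F : DyadicFace n) : Set (Sheets n) :=
  {z | z.1 = F.sheet ∧
    ∀ i, (F.hi i : ℝ) - 1 ≤ 2 ^ F.level * z.2 i ∧ 2 ^ F.level * z.2 i ≤ F.lo i + 1}

/-- The directions in which the face is nondegenerate. -/
abbrev Free (F : DyadicFace n) : Type := {i // F.lo i ≠ F.hi i}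

/-- The dimension of a face. -/
def dim (F : DyadicFace n) : ℕ := Fintype.card F.Free

theorem dim_le (F : DyadicFace n) : F.dim ≤ n :=
  (Fintype.card_subtype_le fun i => F.lo i ≠ F.hi i).trans_eq (Fintype.card_fin n)

/-- The face is a face of one of the cubes of its level. -/
def IsCubical (F : DyadicFace n) : Prop := ∀ i, F.lo i = F.hi i ∨ F.hi i = F.lo i + 1

theorem IsCubical.hi_of_free {F : DyadicFace n} (hF : F.IsCubical) (i : F.Free) :
    (F.hi i : ℝ) = F.lo i + 1 := by
  rw [(hF i).resolve_left i.2]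
  push_cast
  rfl

theorem IsCubical.carrier_subset_star {F : DyadicFace n} (hF : F.IsCubical) :
    F.carrier ⊆ F.star := by
  rintro z ⟨hsheet, hz⟩
  refine ⟨hsheet, fun i => ?_⟩
  obtain ⟨hlo, hhi⟩ := hz i
  obtain h | h := hF i
  · rw [h] at hlo ⊢
    constructor <;> linarith
  · rw [h] at hhi ⊢
    push_cast at hhi ⊢
    constructor <;> linarith

/-! ### Charts of dyadic faces -/

/-- Affine coordinates on a face, taking values in `[-1, 1]`. -/
def coords (F : DyadicFace n) (z : Sheets n) : F.Free → ℝ :=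
  fun i => 2 * (2 ^ F.level * z.2 i) - F.lo i - F.hi i

/-- The affine parametrization of a face that is inverse to `coords`. -/
def param (F : DyadicFace n) (w : F.Free → ℝ) : Sheets n :=
  (F.sheet, fun i => (2 ^ F.level)⁻¹ *
    (if h : F.lo i ≠ F.hi i then ((F.lo i : ℝ) + F.hi i + w ⟨i, h⟩) / 2 else F.lo i))

@[fun_prop]
theorem continuous_coords (F : DyadicFace n) : Continuous F.coords := by
  unfold coords
  fun_prop

@[fun_prop]
theorem continuous_param (F : DyadicFace n) : Continuous F.param := by
  refine continuous_const.prodMk (continuous_pi fun i => ?_)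
  by_cases h : F.lo i = F.hi i
  · simpa [h] using continuous_const
  · simp only [ne_eq, h, not_false_eq_true, dite_true]
    fun_prop

theorem coords_param (F : DyadicFace n) (w : F.Free → ℝ) : F.coords (F.param w) = w := by
  ext i
  have h2 : (2 : ℝ) ^ F.level ≠ 0 := by positivity
  simp only [param, coords, i.2, ne_eq, not_false_eq_true, dite_true]
  field_simp
  ring

theorem param_coords {F : DyadicFace n} {z : Sheets n} (hz : z ∈ F.carrier) :
    F.param (F.coords z) = z := by
  refine Prod.ext hz.1.symm (funext fun i => ?_)
  have h2 : (2 : ℝ) ^ F.level ≠ 0 := by positivity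
  simp only [param, coords]
  split_ifs with hfree
  · field_simp
    ring
  · have hdeg : F.lo i = F.hi i := not_not.1 hfree
    obtain ⟨hlo, hhi⟩ := hz.2 i
    rw [le_antisymm hlo (hdeg ▸ hhi)]
    field_simp

theorem IsCubical.norm_coords_le {F : DyadicFace n} (hF : F.IsCubical) {z : Sheets n}
    (hz : z ∈ F.carrier) : ‖F.coords z‖ ≤ 1 := by
  rw [pi_norm_le_iff_of_nonneg zero_le_one]
  intro i
  have hfree := hF.hi_of_free i
  obtain ⟨hlo, hhi⟩ := hz.2 i
  rw [Real.norm_eq_abs, abs_le, coords]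
  constructor <;> linarith

theorem IsCubical.param_mem {F : DyadicFace n} (hF : F.IsCubical) {w : F.Free → ℝ}
    (hw : ‖w‖ ≤ 1) : F.param w ∈ F.carrier := by
  refine ⟨rfl, fun i => ?_⟩
  have h2 : (2 : ℝ) ^ F.level ≠ 0 := by positivity
  simp only [param, mul_inv_cancel_left₀ h2]
  split_ifs with hfree
  · have hhi : (F.hi i : ℝ) = F.lo i + 1 := hF.hi_of_free ⟨i, hfree⟩
    obtain ⟨hw₁, hw₂⟩ := abs_le.1 ((norm_le_pi_norm w ⟨i, hfree⟩).trans hw)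
    constructor <;> linarith
  · exact ⟨le_rfl, by rw [not_not.1 hfree]⟩

theorem IsCubical.isCompact_carrier {F : DyadicFace n} (hF : F.IsCubical) :
    IsCompact F.carrier := by
  have himage : F.carrier = F.param '' Metric.closedBall 0 1 := by
    refine Set.Subset.antisymm (fun z hz => ⟨F.coords z, ?_, param_coords hz⟩) ?_
    · simpa using hF.norm_coords_le hz
    · rintro _ ⟨w, hw, rfl⟩
      exact hF.param_mem (by simpa using hw)
  rw [himage]
  exact (isCompact_closedBall _ _).image F.continuous_param

theorem IsCubical.norm_coords_eq_one_iff {F : DyadicFace n} (hF : F.IsCubical) {z : Sheets n}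
    (hz : z ∈ F.carrier) :
    ‖F.coords z‖ = 1 ↔
      ∃ i : F.Free, 2 ^ F.level * z.2 i = F.lo i ∨ 2 ^ F.level * z.2 i = F.hi i := by
  have hcoord : ∀ i : F.Free, ‖F.coords z i‖ = 1 ↔
      2 ^ F.level * z.2 i = F.lo i ∨ 2 ^ F.level * z.2 i = F.hi i := fun i => by
    have hfree := hF.hi_of_free i
    rw [Real.norm_eq_abs, abs_eq zero_le_one, coords, or_comm]
    refine or_congr ⟨fun h => ?_, fun h => ?_⟩ ⟨fun h => ?_, fun h => ?_⟩ <;> linarith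
  simp only [← hcoord]
  constructor
  · intro h
    by_contra! hne
    exact h.not_lt <| (pi_norm_lt_iff zero_lt_one).2 fun i =>
      ((norm_le_pi_norm _ i).trans_eq h).lt_of_ne (hne i)
  · rintro ⟨i, hi⟩
    exact le_antisymm (hF.norm_coords_le hz) (hi ▸ norm_le_pi_norm _ i)

/-- The cylinder over a face. -/
def cylinder (F : DyadicFace n) : Set (ℝ × Sheets n) := Set.Icc (-1) 1 ×ˢ F.carrier

/-- Coordinates on the cylinder over a face. Since the time interval is `[-1, 1]`, they identify the
cylinder with the closed unit ball of the sup norm. -/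
def cylinderCoords (F : DyadicFace n) (q : ℝ × Sheets n) : ℝ × (F.Free → ℝ) := (q.1, F.coords q.2)

/-- The affine parametrization of the cylinder over a face that is inverse to `cylinderCoords`. -/
def cylinderParam (F : DyadicFace n) (w : ℝ × (F.Free → ℝ)) : ℝ × Sheets n := (w.1, F.param w.2)

/-- The union of the bottom, the top and the cylinder over the boundary of the face. -/
def cylinderBoundary (F : DyadicFace n) : Set (ℝ × Sheets n) :=
  {q ∈ F.cylinder | ‖F.cylinderCoords q‖ = 1}

@[fun_prop]
theorem continuous_cylinderCoords (F : DyadicFace n) : Continuous F.cylinderCoords := by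
  unfold cylinderCoords
  fun_prop

@[fun_prop]
theorem continuous_cylinderParam (F : DyadicFace n) : Continuous F.cylinderParam := by
  unfold cylinderParam
  fun_prop

theorem cylinderCoords_param (F : DyadicFace n) (w : ℝ × (F.Free → ℝ)) :
    F.cylinderCoords (F.cylinderParam w) = w :=
  Prod.ext rfl (F.coords_param w.2)

theorem cylinderParam_coords {F : DyadicFace n} {q : ℝ × Sheets n} (hq : q ∈ F.cylinder) :
    F.cylinderParam (F.cylinderCoords q) = q :=
  Prod.ext rfl (param_coords hq.2)

theorem IsCubical.cylinderParam_mem_cylinderBoundary {F : DyadicFace n} (hF : F.IsCubical)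
    {w : ℝ × (F.Free → ℝ)} (hw : ‖w‖ = 1) : F.cylinderParam w ∈ F.cylinderBoundary := by
  have ht : -1 ≤ w.1 ∧ w.1 ≤ 1 := abs_le.1 (hw ▸ norm_fst_le w)
  exact ⟨⟨ht, hF.param_mem (hw ▸ norm_snd_le w)⟩, by rw [cylinderCoords_param, hw]⟩

theorem IsCubical.mem_cylinderBoundary_iff {F : DyadicFace n} (hF : F.IsCubical)
    {q : ℝ × Sheets n} :
    q ∈ F.cylinderBoundary ↔ q ∈ F.cylinder ∧ (q.1 = -1 ∨ q.1 = 1 ∨ ‖F.coords q.2‖ = 1) := by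
  refine and_congr_right fun hq => ?_
  have htime : |q.1| ≤ 1 := abs_le.2 hq.1
  have hface : ‖F.coords q.2‖ ≤ 1 := hF.norm_coords_le hq.2
  rw [cylinderCoords, Prod.norm_mk, Real.norm_eq_abs, ← or_assoc, or_comm (a := q.1 = -1),
    ← abs_eq zero_le_one]
  constructor
  · intro h
    exact (max_choice |q.1| ‖F.coords q.2‖).imp (·.symm.trans h) (·.symm.trans h)
  · rintro (h | h)
    exacts [h ▸ max_eq_left (h ▸ hface), h ▸ max_eq_right (h ▸ htime)]

end DyadicFace

/-! ### The dyadic grids -/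

namespace DyadicFace

variable {n : ℕ}

/-- The dyadic face of level `l` whose relative interior contains `z`. -/
def containing (l : ℕ) (z : Sheets n) : DyadicFace n :=
  ⟨z.1, l, fun i => ⌊2 ^ l * z.2 i⌋, fun i => ⌈2 ^ l * z.2 i⌉⟩

theorem mem_carrier_containing (l : ℕ) (z : Sheets n) : z ∈ (containing l z).carrier :=
  ⟨rfl, fun _ => ⟨Int.floor_le _, Int.le_ceil _⟩⟩

theorem isCubical_containing (l : ℕ) (z : Sheets n) : (containing l z).IsCubical := by
  intro i
  simp only [containing]
  have hle := Int.floor_le_ceil (2 ^ l * z.2 i)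
  have hle' := Int.ceil_le_floor_add_one (2 ^ l * z.2 i)
  omega

theorem IsCubical.containing_eq_of_norm_coords_ne {F : DyadicFace n} (hF : F.IsCubical)
    {z : Sheets n} (hz : z ∈ F.carrier) (h : ‖F.coords z‖ ≠ 1) : containing F.level z = F := by
  have hfloor_ceil : ∀ i, ⌊2 ^ F.level * z.2 i⌋ = F.lo i ∧ ⌈2 ^ F.level * z.2 i⌉ = F.hi i := by
    intro i
    obtain ⟨hlo, hhi⟩ := hz.2 i
    by_cases hi : F.lo i = F.hi i
    · have heq : 2 ^ F.level * z.2 i = F.lo i := le_antisymm (hi ▸ hhi) hlo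
      rw [heq, ← hi]
      exact ⟨Int.floor_intCast _, Int.ceil_intCast _⟩
    · have hfree : (F.hi i : ℝ) = F.lo i + 1 := hF.hi_of_free ⟨i, hi⟩
      have hinterior := mt (hF.norm_coords_eq_one_iff hz).2 h
      push Not at hinterior
      have hlo' := hlo.lt_of_ne (hinterior ⟨i, hi⟩).1.symm
      have hhi' := hhi.lt_of_ne (hinterior ⟨i, hi⟩).2
      exact ⟨Int.floor_eq_iff.2 ⟨hlo, by linarith⟩, Int.ceil_eq_iff.2 ⟨by linarith, hhi⟩⟩
  exact DyadicFace.ext hz.1 rfl (funext fun i => (hfloor_ceil i).1)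
    (funext fun i => (hfloor_ceil i).2)

theorem two_pow_mul_eq {l m : ℕ} (h : l ≤ m) (t : ℝ) :
    (2 : ℝ) ^ m * t = ((2 ^ (m - l) : ℤ) : ℝ) * (2 ^ l * t) := by
  push_cast
  rw [← mul_assoc, ← pow_add, Nat.sub_add_cancel h]

theorem carrier_containing_subset {F : DyadicFace n} {m : ℕ} (h : F.level ≤ m) {z : Sheets n}
    (hz : z ∈ F.carrier) : (containing m z).carrier ⊆ F.carrier := by
  rintro q ⟨hsheet, hq⟩
  refine ⟨hsheet.trans hz.1, fun i => ?_⟩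
  obtain ⟨hlo, hhi⟩ := hz.2 i
  obtain ⟨hfloor, hceil⟩ := hq i
  have hpos : (0 : ℝ) < ((2 ^ (m - F.level) : ℤ) : ℝ) := by positivity
  constructor
  · refine le_of_mul_le_mul_left ?_ hpos
    rw [← two_pow_mul_eq h, ← Int.cast_mul]
    refine (Int.cast_le.2 (Int.le_floor.2 ?_)).trans hfloor
    rw [two_pow_mul_eq h, Int.cast_mul]
    exact mul_le_mul_of_nonneg_left hlo hpos.le
  · refine le_of_mul_le_mul_left ?_ hpos
    rw [← two_pow_mul_eq h, ← Int.cast_mul]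
    refine hceil.trans (Int.cast_le.2 (Int.ceil_le.2 ?_))
    rw [two_pow_mul_eq h, Int.cast_mul]
    exact mul_le_mul_of_nonneg_left hhi hpos.le

/-- A coordinate of `z` that is integral on the grid of `F` stays integral on every finer grid, so
only free directions of `F` can be free for the finer face, and a boundary point loses one. -/
theorem IsCubical.dim_containing_lt {F : DyadicFace n} (hF : F.IsCubical) {m : ℕ}
    (h : F.level ≤ m) {z : Sheets n} (hz : z ∈ F.carrier) (hb : ‖F.coords z‖ = 1) :
    (containing m z).dim < F.dim := by
  have hdegenerate : ∀ j (c : ℤ), 2 ^ F.level * z.2 j = c →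
      (containing m z).lo j = (containing m z).hi j := fun j c hc => by
    simp only [containing]
    rw [two_pow_mul_eq h, hc, ← Int.cast_mul, Int.floor_intCast, Int.ceil_intCast]
  have hfree : ∀ j, (containing m z).lo j ≠ (containing m z).hi j → F.lo j ≠ F.hi j :=
    fun j hj hF' => hj <| hdegenerate j (F.lo j) <|
      le_antisymm (hF' ▸ (hz.2 j).2) (hz.2 j).1
  obtain ⟨i, hi⟩ := (hF.norm_coords_eq_one_iff hz).1 hb
  have hi' : (containing m z).lo i = (containing m z).hi i :=
    hi.elim (hdegenerate i _) (hdegenerate i _)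
  refine Fintype.card_lt_of_injective_of_notMem
    (fun j : (containing m z).Free => (⟨j, hfree j j.2⟩ : F.Free))
    (fun j j' h => Subtype.ext (Subtype.mk.inj h)) (b := i) ?_
  rintro ⟨j, rfl⟩
  exact j.2 hi'

theorem star_containing_subset {m : ℕ} {z z' : Sheets n} (hz : z' ∈ (containing m z).carrier) :
    (containing m z).star ⊆ (containing m z').star := by
  rintro q ⟨hsheet, hq⟩
  refine ⟨hsheet.trans hz.1.symm, fun i => ?_⟩
  have hceil : (⌈2 ^ m * z'.2 i⌉ : ℝ) ≤ ⌈2 ^ m * z.2 i⌉ := Int.cast_le.2 (Int.ceil_le.2 (hz.2 i).2)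
  have hfloor : (⌊2 ^ m * z.2 i⌋ : ℝ) ≤ ⌊2 ^ m * z'.2 i⌋ :=
    Int.cast_le.2 (Int.le_floor.2 (hz.2 i).1)
  exact ⟨(sub_le_sub_right hceil 1).trans (hq i).1, (hq i).2.trans (add_le_add_left hfloor 1)⟩

theorem dist_le_of_mem_star {l : ℕ} {z q : Sheets n} (hq : q ∈ (containing l z).star) :
    dist q z ≤ (2 ^ l : ℝ)⁻¹ := by
  have hpos : (0 : ℝ) < 2 ^ l := by positivity
  refine max_le ?_ ((dist_pi_le_iff (by positivity)).2 fun i => ?_)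
  · rw [show q.1 = z.1 from hq.1, dist_self]
    positivity
  · obtain ⟨hlo, hhi⟩ : (⌈2 ^ l * z.2 i⌉ : ℝ) - 1 ≤ 2 ^ l * q.2 i ∧
      2 ^ l * q.2 i ≤ ⌊2 ^ l * z.2 i⌋ + 1 := hq.2 i
    have hfloor := Int.floor_le (2 ^ l * z.2 i)
    have hceil := Int.le_ceil (2 ^ l * z.2 i)
    rw [Real.dist_eq, ← one_div, le_div_iff₀' hpos]
    nth_rw 1 [← abs_of_pos hpos]
    rw [← abs_mul, abs_le]
    constructor <;> linarith

theorem finite_setOf_isCubical_inter_nonempty (l : ℕ) {B : Set (Sheets n)}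
    (hB : Bornology.IsBounded B) :
    {F : DyadicFace n | F.IsCubical ∧ F.level = l ∧ (F.carrier ∩ B).Nonempty}.Finite := by
  obtain ⟨R, hR⟩ := hB.subset_closedBall 0
  let lower : ℤ := ⌈-(2 ^ l * R)⌉ - 1
  let upper : ℤ := ⌊2 ^ l * R⌋ + 1
  have hbox : (Set.Iic ⌊R⌋₊ ×ˢ {l} ×ˢ Set.Icc (fun _ : Fin n => lower) (fun _ => upper) ×ˢ
      Set.Icc (fun _ : Fin n => lower) (fun _ => upper)).Finite :=
    (Set.finite_Iic _).prod ((Set.finite_singleton l).prod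
      ((Set.finite_Icc _ _).prod (Set.finite_Icc _ _)))
  refine (hbox.preimage toTuple_injective.injOn).subset ?_
  rintro F ⟨hF, rfl, q, ⟨hsheet, hq⟩, hqB⟩
  have hqR : dist q 0 ≤ R := hR hqB
  obtain ⟨hq₁, hq₂⟩ := max_le_iff.1 (Prod.dist_eq.symm.trans_le hqR)
  have hbounds : ∀ i, (lower ≤ F.lo i ∧ F.lo i ≤ upper) ∧ lower ≤ F.hi i ∧ F.hi i ≤ upper := by
    intro i
    obtain ⟨hqlo, hqhi⟩ := abs_le.1 ((norm_le_pi_norm q.2 i).trans (dist_zero_right q.2 ▸ hq₂))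
    have hpow : (0 : ℝ) ≤ 2 ^ F.level := by positivity
    have hlo : F.lo i ≤ ⌊2 ^ F.level * R⌋ :=
      Int.le_floor.2 ((hq i).1.trans (mul_le_mul_of_nonneg_left hqhi hpow))
    have hhi : ⌈-(2 ^ F.level * R)⌉ ≤ F.hi i := Int.ceil_le.2 <|
      (mul_neg (2 ^ F.level : ℝ) R ▸ mul_le_mul_of_nonneg_left hqlo hpow).trans (hq i).2
    have hcubical := hF i
    omega
  refine ⟨Nat.le_floor ?_, rfl, ⟨fun i => (hbounds i).1.1, fun i => (hbounds i).1.2⟩,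
    fun i => (hbounds i).2.1, fun i => (hbounds i).2.2⟩
  simpa [Nat.dist_eq, toTuple, ← hsheet] using hq₁

end DyadicFace

/-! ### The dyadic cell decomposition of an open set -/

namespace DyadicFace

variable {n : ℕ} {U : Set (Sheets n)}

/-- The least level at which the star of the dyadic face around `z` is contained in `U`. -/
def cellLevel (U : Set (Sheets n)) (z : Sheets n) : ℕ :=
  sInf {l | (containing l z).star ⊆ U}

/-- The cell of the dyadic decomposition of `U` whose relative interior contains `z`. -/
def cell (U : Set (Sheets n)) (z : Sheets n) : DyadicFace n :=
  containing (cellLevel U z) z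

/-- The cells of the dyadic decomposition of `U`. -/
def cells (U : Set (Sheets n)) : Set (DyadicFace n) := cell U '' U

theorem mem_carrier_cell (z : Sheets n) : z ∈ (cell U z).carrier :=
  mem_carrier_containing _ z

theorem cell_mem_cells {z : Sheets n} (hz : z ∈ U) : cell U z ∈ cells U :=
  Set.mem_image_of_mem _ hz

theorem isCubical_of_mem_cells {F : DyadicFace n} (hF : F ∈ cells U) : F.IsCubical := by
  obtain ⟨z, -, rfl⟩ := hF
  exact isCubical_containing _ z

theorem exists_forall_cellLevel_le (hU : IsOpen U) {K : Set (Sheets n)} (hK : IsCompact K)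
    (hKU : K ⊆ U) : ∃ L, ∀ z ∈ K, (containing L z).star ⊆ U ∧ cellLevel U z ≤ L := by
  obtain ⟨δ, hδ, hthick⟩ := hK.exists_thickening_subset_open hU hKU
  obtain ⟨L, hL⟩ := exists_pow_lt_of_lt_one hδ (by norm_num : (2⁻¹ : ℝ) < 1)
  refine ⟨L, fun z hz => ?_⟩
  have hstar : (containing L z).star ⊆ U := fun q hq =>
    hthick (Metric.ball_subset_thickening hz δ
      ((dist_le_of_mem_star hq).trans_lt (by rwa [← inv_pow])))
  exact ⟨hstar, Nat.sInf_le hstar⟩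

theorem star_cell_subset (hU : IsOpen U) {z : Sheets n} (hz : z ∈ U) : (cell U z).star ⊆ U := by
  obtain ⟨L, hL⟩ :=
    exists_forall_cellLevel_le hU isCompact_singleton (Set.singleton_subset_iff.2 hz)
  exact Nat.sInf_mem (s := {l | (containing l z).star ⊆ U}) ⟨L, (hL z rfl).1⟩

theorem carrier_subset_of_mem_cells (hU : IsOpen U) {F : DyadicFace n} (hF : F ∈ cells U) :
    F.carrier ⊆ U := by
  obtain ⟨z, hz, rfl⟩ := hF
  exact (isCubical_containing _ z).carrier_subset_star.trans (star_cell_subset hU hz)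

theorem level_le_cellLevel (hU : IsOpen U) {F : DyadicFace n} (hF : F ∈ cells U) {z : Sheets n}
    (hz : z ∈ F.carrier) : F.level ≤ cellLevel U z := by
  have hzU := carrier_subset_of_mem_cells hU hF hz
  obtain ⟨y, -, rfl⟩ := hF
  by_contra! hlt
  have hcoarse : (cell U y).carrier ⊆ (containing (cellLevel U z) y).carrier :=
    carrier_containing_subset (F := containing (cellLevel U z) y) hlt.le
      (mem_carrier_containing _ y)
  exact hlt.not_ge (Nat.sInf_le
    ((star_containing_subset (hcoarse hz)).trans (star_cell_subset hU hzU)))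

theorem cell_eq_of_norm_coords_ne (hU : IsOpen U) {F : DyadicFace n} (hF : F ∈ cells U)
    {z : Sheets n} (hz : z ∈ F.carrier) (h : ‖F.coords z‖ ≠ 1) : cell U z = F := by
  have hcontaining : containing F.level z = F :=
    (isCubical_of_mem_cells hF).containing_eq_of_norm_coords_ne hz h
  have hlevel : cellLevel U z = F.level := by
    refine le_antisymm (Nat.sInf_le ?_) (level_le_cellLevel hU hF hz)
    rw [Set.mem_ofPred_eq, hcontaining]
    obtain ⟨y, hy, rfl⟩ := hF
    exact star_cell_subset hU hy
  rw [cell, hlevel, hcontaining]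

theorem dim_cell_lt (hU : IsOpen U) {F : DyadicFace n} (hF : F ∈ cells U) {z : Sheets n}
    (hz : z ∈ F.carrier) (h : ‖F.coords z‖ = 1) : (cell U z).dim < F.dim :=
  (isCubical_of_mem_cells hF).dim_containing_lt (level_le_cellLevel hU hF hz) hz h

theorem finite_cells_inter (hU : IsOpen U) {K : Set (Sheets n)} (hK : IsCompact K) (hKU : K ⊆ U) :
    {F ∈ cells U | (F.carrier ∩ K).Nonempty}.Finite := by
  obtain ⟨L, hL⟩ := exists_forall_cellLevel_le hU hK hKU
  refine ((Set.finite_Iic L).biUnion fun l _ =>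
    finite_setOf_isCubical_inter_nonempty l hK.isBounded).subset ?_
  rintro F ⟨hF, q, hq, hqK⟩
  exact Set.mem_biUnion ((level_le_cellLevel hU hF hq).trans (hL q hqK).2)
    ⟨isCubical_of_mem_cells hF, rfl, q, hq, hqK⟩

end DyadicFace

/-! ### Nullhomotopies by induction over skeleta -/

namespace DyadicFace

variable {n k : ℕ} {U : Set (Sheets n)} {A : Type*} {H : ℝ × Sheets n → A}

theorem dim_cell_lt_or_cell_eq (hU : IsOpen U) {F : DyadicFace n} (hF : F ∈ cells U)
    {z : Sheets n} (hz : z ∈ F.carrier) :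
    (‖F.coords z‖ = 1 ∧ (cell U z).dim < F.dim) ∨ cell U z = F := by
  by_cases h : ‖F.coords z‖ = 1
  exacts [Or.inl ⟨h, dim_cell_lt hU hF hz h⟩, Or.inr (cell_eq_of_norm_coords_ne hU hF hz h)]

/-- The map `H` changed to `Φ F` on the cylinder over the interior of each `k`-cell `F`. -/
def replaceOnCells (U : Set (Sheets n)) (k : ℕ) (H : ℝ × Sheets n → A)
    (Φ : DyadicFace n → ℝ × Sheets n → A) (q : ℝ × Sheets n) : A :=
  open Classical in
  if cell U q.2 ∈ cells U ∧ (cell U q.2).dim = k then Φ (cell U q.2) q else H q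

section replaceOnCells

variable {Φ : DyadicFace n → ℝ × Sheets n → A} {F : DyadicFace n}

theorem replaceOnCells_of_dim_cell_lt {q : ℝ × Sheets n} (hq : (cell U q.2).dim < k) :
    replaceOnCells U k H Φ q = H q :=
  if_neg fun h => hq.ne h.2

theorem eqOn_replaceOnCells_of_dim_lt (hU : IsOpen U) (hF : F ∈ cells U) (hk : F.dim < k) :
    Set.EqOn (replaceOnCells U k H Φ) H F.cylinder := fun q hq => by
  obtain ⟨-, hlt⟩ | heq := dim_cell_lt_or_cell_eq hU hF hq.2
  exacts [replaceOnCells_of_dim_cell_lt (hlt.trans hk), replaceOnCells_of_dim_cell_lt (heq ▸ hk)]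

theorem eqOn_replaceOnCells_of_dim_eq (hU : IsOpen U) (hF : F ∈ cells U) (hk : F.dim = k)
    (hΦ : Set.EqOn (Φ F) H F.cylinderBoundary) :
    Set.EqOn (replaceOnCells U k H Φ) (Φ F) F.cylinder := fun q hq => by
  obtain ⟨hnorm, hlt⟩ | rfl := dim_cell_lt_or_cell_eq hU hF hq.2
  · rw [replaceOnCells_of_dim_cell_lt (hlt.trans_eq hk)]
    exact (hΦ ((isCubical_of_mem_cells hF).mem_cylinderBoundary_iff.2
      ⟨hq, Or.inr (Or.inr hnorm)⟩)).symm
  · exact if_pos ⟨hF, hk⟩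

theorem replaceOnCells_of_abs_eq_one
    (hΦ : ∀ F ∈ cells U, F.dim = k → Set.EqOn (Φ F) H F.cylinderBoundary) {q : ℝ × Sheets n}
    (hq : q.1 = -1 ∨ q.1 = 1) : replaceOnCells U k H Φ q = H q := by
  rw [replaceOnCells]
  split_ifs with h
  · have htime : q.1 ∈ Set.Icc (-1) 1 := by rcases hq with hq | hq <;> simp [hq]
    exact hΦ _ h.1 h.2 ((isCubical_of_mem_cells h.1).mem_cylinderBoundary_iff.2
      ⟨⟨htime, mem_carrier_cell _⟩, by tauto⟩)
  · rfl

end replaceOnCells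

variable [TopologicalSpace A] {a : A} {G : Sheets n → A}

/-- A nullhomotopy of `G`, parametrized by `[-1, 1]`, that is continuous on the cylinder over each
cell of `U` of dimension less than `k`, and such that these cylinders converge to `a`. There is no
condition on the rest of `U`. -/
structure IsSkeletalNullhomotopy (U : Set (Sheets n)) (G : Sheets n → A) (a : A) (k : ℕ)
    (H : ℝ × Sheets n → A) : Prop where
  apply_neg_one : ∀ z, H (-1, z) = G z
  apply_one : ∀ z, H (1, z) = a
  continuousOn : ∀ F ∈ cells U, F.dim < k → ContinuousOn H F.cylinder
  eventually_mapsTo : ∀ V ∈ 𝓝 a, ∀ᶠ F in cofinite, F ∈ cells U → F.dim < k →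
    Set.MapsTo H F.cylinder V

namespace IsSkeletalNullhomotopy

theorem continuousOn_prod (hH : IsSkeletalNullhomotopy U G a k H) (hU : IsOpen U)
    {K : Set (Sheets n)} (hK : IsCompact K) (hKU : K ⊆ U) (hd : ∀ z ∈ K, (cell U z).dim < k) :
    ContinuousOn H (Set.Icc (-1) 1 ×ˢ K) := by
  let T : Set (DyadicFace n) := {F | (F ∈ cells U ∧ (F.carrier ∩ K).Nonempty) ∧ F.dim < k}
  have : Finite T := ((finite_cells_inter hU hK hKU).subset (Set.sep_subset _ _)).to_subtype
  have hT : ContinuousOn H (⋃ F : T, F.1.cylinder) :=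
    (locallyFinite_of_finite _).continuousOn_iUnion
      (fun F => isClosed_Icc.prod (isCubical_of_mem_cells F.2.1.1).isCompact_carrier.isClosed)
      (fun F => hH.continuousOn F F.2.1.1 F.2.2)
  refine hT.mono fun q hq => Set.mem_iUnion.2 ⟨⟨cell U q.2, ?_⟩, hq.1, mem_carrier_cell _⟩
  exact ⟨⟨cell_mem_cells (hKU hq.2), q.2, mem_carrier_cell _, hq.2⟩, hd _ hq.2⟩

theorem exists_isCompact_forall_mem (hH : IsSkeletalNullhomotopy U G a k H) (hU : IsOpen U)
    {V : Set A} (hV : V ∈ 𝓝 a) :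
    ∃ K ⊆ U, IsCompact K ∧ ∀ t ∈ Set.Icc (-1 : ℝ) 1, ∀ z ∈ U \ K, (cell U z).dim < k →
      H (t, z) ∈ V := by
  let bad : Set (DyadicFace n) :=
    {F | ¬(F ∈ cells U → F.dim < k → Set.MapsTo H F.cylinder V)}
  have hbad : ∀ F ∈ bad, F ∈ cells U := fun F hF => by_contra fun h => hF fun h' => absurd h' h
  refine ⟨⋃ F ∈ bad, F.carrier,
    Set.iUnion₂_subset fun F hF => carrier_subset_of_mem_cells hU (hbad F hF),
    (hH.eventually_mapsTo V hV : bad.Finite).isCompact_biUnion fun F hF =>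
      (isCubical_of_mem_cells (hbad F hF)).isCompact_carrier, fun t ht z hz hd => ?_⟩
  have hgood : cell U z ∉ bad := fun h => hz.2 (Set.mem_biUnion h (mem_carrier_cell z))
  exact not_not.1 hgood (cell_mem_cells hz.1) hd ⟨ht, mem_carrier_cell z⟩

theorem continuousOn_cylinderBoundary (hH : IsSkeletalNullhomotopy U G a k H) (hU : IsOpen U)
    (hG : ContinuousOn G U) {F : DyadicFace n} (hF : F ∈ cells U) (hk : F.dim = k) :
    ContinuousOn H F.cylinderBoundary := by
  have hcub := isCubical_of_mem_cells hF
  have hFU := carrier_subset_of_mem_cells hU hF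
  have hclosed : IsClosed F.carrier := hcub.isCompact_carrier.isClosed
  have hbottom : ContinuousOn H ({-1} ×ˢ F.carrier) :=
    (hG.comp continuousOn_snd fun q hq => hFU hq.2).congr fun ⟨t, z⟩ hq => by
      rw [show t = -1 from hq.1]
      exact hH.apply_neg_one z
  have htop : ContinuousOn H ({1} ×ˢ F.carrier) :=
    continuousOn_const.congr fun ⟨t, z⟩ hq => by
      rw [show t = 1 from hq.1]
      exact hH.apply_one z
  have hside_compact : IsCompact (F.carrier ∩ {z | ‖F.coords z‖ = 1}) :=
    hcub.isCompact_carrier.inter_right (isClosed_eq F.continuous_coords.norm continuous_const)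
  have hside := hH.continuousOn_prod hU hside_compact (Set.inter_subset_left.trans hFU)
    fun z hz => (dim_cell_lt hU hF hz.1 hz.2).trans_eq hk
  have hside_closed := isClosed_Icc (a := (-1 : ℝ)) (b := 1) |>.prod hside_compact.isClosed
  refine (hbottom.union_of_isClosed (htop.union_of_isClosed hside (isClosed_singleton.prod hclosed)
    hside_closed) (isClosed_singleton.prod hclosed)
    ((isClosed_singleton.prod hclosed).union hside_closed)).mono fun q hq => ?_
  obtain ⟨⟨htime, hcarrier⟩, h | h | h⟩ := hcub.mem_cylinderBoundary_iff.1 hq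
  exacts [Or.inl ⟨h, hcarrier⟩, Or.inr (Or.inl ⟨h, hcarrier⟩),
    Or.inr (Or.inr ⟨htime, hcarrier, h⟩)]

theorem eventually_mapsTo_cylinderBoundary (hH : IsSkeletalNullhomotopy U G a k H)
    (hU : IsOpen U) {V : Set A} (hV : V ∈ 𝓝 a)
    (hG : ∃ K ⊆ U, IsCompact K ∧ Set.MapsTo G (U \ K) V) :
    ∀ᶠ F in cofinite, F ∈ cells U → F.dim = k → Set.MapsTo H F.cylinderBoundary V := by
  obtain ⟨K, hKU, hK, hKV⟩ := hG
  obtain ⟨K', hKU', hK', hKV'⟩ := hH.exists_isCompact_forall_mem hU hV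
  refine (finite_cells_inter hU (hK.union hK') (Set.union_subset hKU hKU')).subset fun F hbad => ?_
  by_contra hne
  refine hbad fun hF hk q hq => ?_
  have hcub := isCubical_of_mem_cells hF
  obtain ⟨⟨htime, hcarrier⟩, hside⟩ := hcub.mem_cylinderBoundary_iff.1 hq
  have hqU := carrier_subset_of_mem_cells hU hF hcarrier
  have hqK : q.2 ∉ K ∪ K' := fun h => hne ⟨hF, q.2, hcarrier, h⟩
  obtain ⟨t, z⟩ := q
  obtain rfl | rfl | hnorm := hside
  · exact hH.apply_neg_one z ▸ hKV ⟨hqU, fun h => hqK (Or.inl h)⟩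
  · exact hH.apply_one z ▸ mem_of_mem_nhds hV
  · exact hKV' t htime z ⟨hqU, fun h => hqK (Or.inr h)⟩
      ((dim_cell_lt hU hF hcarrier hnorm).trans_eq hk)

theorem exists_extension (hH : IsSkeletalNullhomotopy U G a k H)
    (hA : SequentiallyConnectedAt n A a) (hk : k ≤ n) (hU : IsOpen U) (hGc : ContinuousOn G U)
    (hG : ∀ V ∈ 𝓝 a, ∃ K ⊆ U, IsCompact K ∧ Set.MapsTo G (U \ K) V) :
    ∃ Φ : DyadicFace n → ℝ × Sheets n → A, (∀ F, Continuous (Φ F)) ∧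
      (∀ F ∈ cells U, F.dim = k → Set.EqOn (Φ F) H F.cylinderBoundary) ∧
      ∀ V ∈ 𝓝 a, ∀ᶠ F in cofinite, ∀ q, Φ F q ∈ V := by
  classical
  let T : Set (DyadicFace n) := {F ∈ cells U | F.dim = k}
  have hcub : ∀ F : T, F.1.IsCubical := fun F => isCubical_of_mem_cells F.2.1
  have hcard : ∀ F : T, Fintype.card F.1.Free = k := fun F => F.2.2
  have hsphere : ∀ F : T, Set.MapsTo F.1.cylinderParam (Metric.sphere 0 1) F.1.cylinderBoundary :=
    fun F w hw => (hcub F).cylinderParam_mem_cylinderBoundary (mem_sphere_zero_iff_norm.1 hw)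
  obtain ⟨Ψ, hΨc, hΨ, hΨV⟩ := hA.exists_extension_of_sphere hk
    (fun F : T => cylinderEquivEuclidean (hcard F))
    (φ := fun F w => H (F.1.cylinderParam w))
    (fun F => (hH.continuousOn_cylinderBoundary hU hGc F.2.1 F.2.2).comp
      F.1.continuous_cylinderParam.continuousOn (hsphere F))
    (fun F => by
      rw [radialSection_cylinderEquivEuclidean_base]
      exact hH.apply_one _)
    (fun V hV => Subtype.val_injective.tendsto_cofinite.eventually
      (hH.eventually_mapsTo_cylinderBoundary hU hV (hG V hV)) |>.mono
        fun F hF w hw => hF F.2.1 F.2.2 (hsphere F hw))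
  refine ⟨fun F q => if h : F ∈ T then Ψ ⟨F, h⟩ (F.cylinderCoords q) else a, fun F => ?_,
    fun F hF hdim q hq => ?_, fun V hV => ?_⟩
  · by_cases h : F ∈ T
    · simp only [dif_pos h]
      exact (hΨc ⟨F, h⟩).comp F.continuous_cylinderCoords
    · simp only [dif_neg h]
      exact continuous_const
  · have h : F ∈ T := ⟨hF, hdim⟩
    simp only [dif_pos h]
    exact (hΨ ⟨F, h⟩ (mem_sphere_zero_iff_norm.2 hq.2)).trans
      (congrArg H (cylinderParam_coords hq.1))
  · refine ((hΨV V hV).image Subtype.val).subset fun F hF => ?_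
    by_cases h : F ∈ T
    · exact ⟨⟨F, h⟩, fun hw => hF fun q => by simpa only [dif_pos h] using hw _, rfl⟩
    · exact absurd (fun q => by simpa only [dif_neg h] using mem_of_mem_nhds hV) hF

theorem succ (hH : IsSkeletalNullhomotopy U G a k H) (hU : IsOpen U)
    {Φ : DyadicFace n → ℝ × Sheets n → A} (hΦc : ∀ F, Continuous (Φ F))
    (hΦ : ∀ F ∈ cells U, F.dim = k → Set.EqOn (Φ F) H F.cylinderBoundary)
    (hΦV : ∀ V ∈ 𝓝 a, ∀ᶠ F in cofinite, ∀ q, Φ F q ∈ V) :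
    IsSkeletalNullhomotopy U G a (k + 1) (replaceOnCells U k H Φ) where
  apply_neg_one z := (replaceOnCells_of_abs_eq_one hΦ (Or.inl rfl)).trans (hH.apply_neg_one z)
  apply_one z := (replaceOnCells_of_abs_eq_one hΦ (Or.inr rfl)).trans (hH.apply_one z)
  continuousOn F hF hdim := by
    obtain hlt | heq := Nat.lt_succ_iff_lt_or_eq.1 hdim
    · exact (hH.continuousOn F hF hlt).congr (eqOn_replaceOnCells_of_dim_lt hU hF hlt)
    · exact (hΦc F).continuousOn.congr (eqOn_replaceOnCells_of_dim_eq hU hF heq (hΦ F hF heq))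
  eventually_mapsTo V hV := by
    filter_upwards [hH.eventually_mapsTo V hV, hΦV V hV] with F hlow hfill hF hdim q hq
    obtain hlt | heq := Nat.lt_succ_iff_lt_or_eq.1 hdim
    · rw [eqOn_replaceOnCells_of_dim_lt hU hF hlt hq]
      exact hlow hF hlt hq
    · rw [eqOn_replaceOnCells_of_dim_eq hU hF heq (hΦ F hF heq) hq]
      exact hfill q

end IsSkeletalNullhomotopy

theorem exists_isSkeletalNullhomotopy (hA : SequentiallyConnectedAt n A a) (hU : IsOpen U)
    (hGc : ContinuousOn G U)
    (hG : ∀ V ∈ 𝓝 a, ∃ K ⊆ U, IsCompact K ∧ Set.MapsTo G (U \ K) V) (hk : k ≤ n + 1) :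
    ∃ H, IsSkeletalNullhomotopy U G a k H := by
  induction k with
  | zero =>
    exact ⟨fun q => if q.1 = -1 then G q.2 else a, fun z => if_pos rfl,
      fun z => if_neg (by norm_num),
      fun F _ h => absurd h (Nat.not_lt_zero _),
      fun V _ => .of_forall fun F _ h => absurd h (Nat.not_lt_zero _)⟩
  | succ k ih =>
    obtain ⟨H, hH⟩ := ih (by omega)
    obtain ⟨Φ, hΦc, hΦ, hΦV⟩ := hH.exists_extension hA (by omega) hU hGc hG
    exact ⟨_, hH.succ hU hΦc hΦ hΦV⟩

end DyadicFace

theorem SequentiallyConnectedAt.exists_nullhomotopy_of_isOpen {n : ℕ} {A : Type*}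
    [TopologicalSpace A] {a : A} (hA : SequentiallyConnectedAt n A a) {U : Set (Sheets n)}
    (hU : IsOpen U) {G : Sheets n → A} (hGc : ContinuousOn G U)
    (hG : ∀ V ∈ 𝓝 a, ∃ K ⊆ U, IsCompact K ∧ Set.MapsTo G (U \ K) V) :
    ∃ H : ℝ × Sheets n → A, (∀ z, H (-1, z) = G z) ∧ (∀ z, H (1, z) = a) ∧
      ContinuousOn H (Set.Icc (-1) 1 ×ˢ U) ∧
      ∀ V ∈ 𝓝 a, ∃ K ⊆ U, IsCompact K ∧ Set.MapsTo H (Set.Icc (-1) 1 ×ˢ (U \ K)) V := by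
  obtain ⟨H, hH⟩ := DyadicFace.exists_isSkeletalNullhomotopy hA hU hGc hG le_rfl
  have hdim : ∀ z, (DyadicFace.cell U z).dim < n + 1 := fun z =>
    Nat.lt_succ_of_le (DyadicFace.dim_le _)
  refine ⟨H, hH.apply_neg_one, hH.apply_one, fun q hq => ?_, fun V hV => ?_⟩
  · obtain ⟨K, hKq, hKU, hK⟩ := local_compact_nhds (hU.mem_nhds hq.2)
    refine (hH.continuousOn_prod hU hK hKU fun z _ => hdim z).continuousWithinAt
      ⟨hq.1, mem_of_mem_nhds hKq⟩ |>.mono_of_mem_nhdsWithin ?_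
    exact mem_nhdsWithin_iff_eventually.2 <|
      (continuous_snd.continuousAt.eventually hKq).mono fun q hqK hqU => ⟨hqU.1, hqK⟩
  · obtain ⟨K, hKU, hK, hKV⟩ := hH.exists_isCompact_forall_mem hU hV
    exact ⟨K, hKU, hK, fun q hq => hKV q.1 hq.1 q.2 hq.2 (hdim _)⟩

/-! ### Nullhomotopies relative to the preimage of the basepoint -/

theorem continuous_of_continuousOn_of_isOpen {Q A : Type*} [TopologicalSpace Q]
    [TopologicalSpace A] {O : Set Q} {H : Q → A} {a : A} (hO : IsOpen O) (hc : ContinuousOn H O)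
    (ha : ∀ q ∉ O, H q = a)
    (hV : ∀ V ∈ 𝓝 a, ∃ C ⊆ O, IsClosed C ∧ Set.MapsTo H Cᶜ V) : Continuous H := by
  refine continuous_iff_continuousAt.2 fun q => ?_
  by_cases hq : q ∈ O
  · exact hc.continuousAt (hO.mem_nhds hq)
  · intro V hVq
    obtain ⟨C, hCO, hC, hCV⟩ := hV V (ha q hq ▸ hVq)
    exact mem_map.2 (mem_of_superset (hC.isOpen_compl.mem_nhds fun h => hq (hCO h)) hCV)

theorem exists_isCompact_subset_of_tendsto {Z A : Type*} [TopologicalSpace Z]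
    [TopologicalSpace A] {a : A} {G : Z → A}
    (hGc : Continuous G) (hG : Tendsto G (cocompact Z) (𝓝 a)) {V : Set A} (hV : V ∈ 𝓝 a) :
    ∃ K ⊆ G ⁻¹' {a}ᶜ, IsCompact K ∧ Set.MapsTo G Kᶜ V := by
  obtain ⟨W, hWV, hW, haW⟩ := mem_nhds_iff.1 hV
  obtain ⟨K, hK, hKW⟩ := mem_cocompact.1 (hG (hW.mem_nhds haW))
  refine ⟨K ∩ G ⁻¹' Wᶜ, fun p hp hpa => hp.2 (Set.mem_singleton_iff.1 hpa ▸ haW),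
    hK.inter_right (hW.isClosed_compl.preimage hGc), fun p hp => hWV ?_⟩
  by_contra hpW
  exact hp ⟨by_contra fun hpK => hpW (hKW hpK), hpW⟩

namespace SequentiallyConnectedAt

variable {n : ℕ} {A : Type*} [TopologicalSpace A] {a : A}

theorem exists_nullhomotopy_off_preimage (h : SequentiallyConnectedAt n A a)
    (ha : IsClosed {a}) {Z : Type*} [TopologicalSpace Z] {J : Sheets n → Z}
    (hJ : IsOpenEmbedding J) {G : Z → A} (hGc : Continuous G) (hGJ : ∀ p ∉ Set.range J, G p = a)
    (hG : Tendsto G (cocompact Z) (𝓝 a)) :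
    ∃ H : I × Z → A, (∀ p, G p ≠ a → H (0, p) = G p ∧ H (1, p) = a) ∧
      ContinuousOn H (Set.univ ×ˢ (G ⁻¹' {a}ᶜ)) ∧
      ∀ V ∈ 𝓝 a, ∃ K ⊆ G ⁻¹' {a}ᶜ, IsCompact K ∧
        Set.MapsTo H (Set.univ ×ˢ (G ⁻¹' {a}ᶜ \ K)) V := by
  have hrange : G ⁻¹' {a}ᶜ ⊆ Set.range J := fun p hp => by_contra fun hpJ => hp (hGJ p hpJ)
  have hGV : ∀ V ∈ 𝓝 a, ∃ K ⊆ (G ∘ J) ⁻¹' {a}ᶜ, IsCompact K ∧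
      Set.MapsTo (G ∘ J) ((G ∘ J) ⁻¹' {a}ᶜ \ K) V := fun V hV => by
    obtain ⟨K, hKU, hK, hKV⟩ := exists_isCompact_subset_of_tendsto hGc hG hV
    exact ⟨J ⁻¹' K, Set.preimage_mono hKU,
      hJ.isInducing.isCompact_preimage' hK (hKU.trans hrange), fun z hz => hKV hz.2⟩
  obtain ⟨H, H0, H1, Hc, HV⟩ := h.exists_nullhomotopy_of_isOpen
    (ha.isOpen_compl.preimage (hGc.comp hJ.continuous)) (hGc.comp hJ.continuous).continuousOn hGV
  let e := hJ.toOpenPartialHomeomorph J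
  have hright : ∀ p, G p ≠ a → J (e.symm p) = p := fun p hp =>
    hJ.toOpenPartialHomeomorph_right_inv J (hrange hp)
  have htime : ∀ s : I, 2 * (s : ℝ) - 1 ∈ Set.Icc (-1 : ℝ) 1 := fun s =>
    ⟨by linarith [s.2.1], by linarith [s.2.2]⟩
  refine ⟨fun q => H (2 * (q.1 : ℝ) - 1, e.symm q.2), fun p hp => ⟨?_, ?_⟩, ?_, fun V hV => ?_⟩
  · simp [H0, hright p hp]
  · norm_num [H1]
  · have hsymm : ContinuousOn e.symm (G ⁻¹' {a}ᶜ) :=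
      e.continuousOn_symm.mono (by simpa [e] using hrange)
    refine Hc.comp (ContinuousOn.prodMk (by fun_prop)
      (hsymm.comp continuousOn_snd fun q hq => hq.2)) fun q hq => ⟨htime q.1, ?_⟩
    exact (congrArg G (hright q.2 hq.2)).trans_ne hq.2
  · obtain ⟨K, hKU, hK, hKV⟩ := HV V hV
    refine ⟨J '' K, Set.image_subset_iff.2 hKU, hK.image hJ.continuous, fun q hq =>
      hKV ⟨htime q.1, (congrArg G (hright q.2 hq.2.1)).trans_ne hq.2.1, fun hqK => hq.2.2 ?_⟩⟩
    exact ⟨_, hqK, hright q.2 hq.2.1⟩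

theorem exists_nullhomotopy_rel (h : SequentiallyConnectedAt n A a) (ha : IsClosed {a})
    {Z : Type*} [TopologicalSpace Z] [T2Space Z] {J : Sheets n → Z} (hJ : IsOpenEmbedding J)
    (G : C(Z, A)) (hGJ : ∀ p ∉ Set.range J, G p = a) (hG : Tendsto G (cocompact Z) (𝓝 a)) :
    ∃ H : C(I × Z, A), (∀ p, H (0, p) = G p) ∧ (∀ p, H (1, p) = a) ∧
      (∀ s p, G p = a → H (s, p) = a) ∧ Tendsto H (cocompact (I × Z)) (𝓝 a) := by
  classical
  obtain ⟨H₀, H₀ends, H₀c, H₀V⟩ :=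
    h.exists_nullhomotopy_off_preimage ha hJ G.continuous hGJ hG
  let H : I × Z → A := fun q => if G q.2 = a then a else H₀ q
  have hV : ∀ V ∈ 𝓝 a, ∃ K ⊆ G ⁻¹' {a}ᶜ, IsCompact K ∧ Set.MapsTo H (Set.univ ×ˢ K)ᶜ V := by
    intro V hV
    obtain ⟨K, hKU, hK, hKV⟩ := H₀V V hV
    refine ⟨K, hKU, hK, fun q hq => ?_⟩
    by_cases hqa : G q.2 = a
    · simpa only [H, if_pos hqa] using mem_of_mem_nhds hV
    · simpa only [H, if_neg hqa] using hKV ⟨trivial, hqa, fun hqK => hq ⟨trivial, hqK⟩⟩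
  have hc : Continuous H := by
    refine continuous_of_continuousOn_of_isOpen (O := Set.univ ×ˢ (G ⁻¹' {a}ᶜ))
      (isOpen_univ.prod (ha.isOpen_compl.preimage G.continuous))
      (H₀c.congr fun q hq => if_neg hq.2)
      (fun q hq => if_pos (by_contra fun hqa => hq ⟨trivial, hqa⟩)) fun V hVa => ?_
    obtain ⟨K, hKU, hK, hKV⟩ := hV V hVa
    exact ⟨Set.univ ×ˢ K, Set.prod_mono_right hKU, isClosed_univ.prod hK.isClosed, hKV⟩
  refine ⟨⟨H, hc⟩, fun p => ?_, fun p => ?_, fun s p hp => if_pos hp, fun V hVa => ?_⟩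
  · by_cases hp : G p = a
    exacts [(if_pos hp).trans hp.symm, (if_neg hp).trans (H₀ends p hp).1]
  · by_cases hp : G p = a
    exacts [if_pos hp, (if_neg hp).trans (H₀ends p hp).2]
  · obtain ⟨K, -, hK, hKV⟩ := hV V hVa
    exact mem_cocompact.2 ⟨Set.univ ×ˢ K, isCompact_univ.prod hK, hKV⟩

theorem exists_sequential_nullhomotopy_rel (h : SequentiallyConnectedAt n A a)
    (ha : IsClosed {a}) {K : Type*} [TopologicalSpace K] [CompactSpace K] [T2Space K]
    {e : (Fin n → ℝ) → K} (he : IsOpenEmbedding e) {g : ℕ → C(K, A)} (hg : ConvergesToPoint g a)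
    (hge : ∀ m, ∀ p ∉ Set.range e, g m p = a) :
    ∃ H : ℕ → C(I × K, A), (∀ m p, H m (0, p) = g m p) ∧ (∀ m p, H m (1, p) = a) ∧
      (∀ m s p, g m p = a → H m (s, p) = a) ∧ ConvergesToPoint H a := by
  obtain ⟨H, H0, H1, Ha, HV⟩ := h.exists_nullhomotopy_rel ha
    (J := Prod.map (id : ℕ → ℕ) e) (IsOpenEmbedding.id.prodMap he)
    ⟨fun q => g q.1 q.2, continuous_prod_of_discrete_left.2 fun m => (g m).continuous⟩
    (fun q hq => hge q.1 q.2 fun ⟨z, hz⟩ => hq ⟨(q.1, z), Prod.ext rfl hz⟩)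
    (convergesToPoint_iff_tendsto_cocompact.1 hg)
  let swapLevel : ℕ × I × K ≃ₜ I × ℕ × K :=
    (Homeomorph.prodAssoc ℕ I K).symm.trans
      (((Homeomorph.prodComm ℕ I).prodCongr (Homeomorph.refl K)).trans (Homeomorph.prodAssoc I ℕ K))
  exact ⟨fun m => ⟨fun q => H (q.1, m, q.2), by fun_prop⟩, fun m p => H0 (m, p),
    fun m p => H1 (m, p), fun m s p => Ha s (m, p),
    convergesToPoint_iff_tendsto_cocompact.2
      (HV.comp swapLevel.isClosedEmbedding.tendsto_cocompact)⟩

end SequentiallyConnectedAt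

/-! ### Coordinates on shrinking adjunction spaces -/

/-- The tuples `(p, (q_j)_j)` that occur as coordinates `(r y, (r_j y)_j)` of a point `y` of
`Adj(X, x_j, A_j, a_j)`, where `r_j` retracts onto `A_j`: at most one `q_j` differs from `a_j`, and
if `q_j` does then `p = x_j`. -/
def AdjCoords {X : Type*} (x : ℕ → X) (A : ℕ → Type*) (a : ∀ j, A j) : Set (X × ∀ j, A j) :=
  {c | ∀ j, c.2 j ≠ a j → c.1 = x j ∧ ∀ i, i ≠ j → c.2 i = a i}

namespace FiniteAdj

variable {X : Type*} {x : ℕ → X} {A : ℕ → Type*} {a : ∀ j, A j} {k : ℕ}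

/-- The inclusion of the core `X`. -/
def inl (p : X) : FiniteAdj x A a k := Quot.mk _ (Sum.inl p)

/-- The inclusion of the attached space `A j`. -/
def inr (j : Fin k) (p : A j) : FiniteAdj x A a k := Quot.mk _ (Sum.inr ⟨j, p⟩)

theorem inr_basepoint (j : Fin k) : (inr j (a j) : FiniteAdj x A a k) = inl (x j) :=
  (Quot.sound (AdjRel.glue j)).symm

@[elab_as_elim]
theorem induction {motive : FiniteAdj x A a k → Prop} (inl : ∀ p, motive (inl p))
    (inr : ∀ j p, motive (inr j p)) (z : FiniteAdj x A a k) : motive z :=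
  Quot.ind (Sum.rec inl fun q => inr q.1 q.2) z

/-- The retraction onto the attached space `A j`, collapsing everything else to `a j`; it is
constant if `j ≥ k`. -/
def coord (j : ℕ) : FiniteAdj x A a k → A j :=
  Quot.lift (Sum.elim (fun _ => a j) (fun q => if h : (q.1 : ℕ) = j then h ▸ q.2 else a j))
    (by
      rintro _ _ ⟨i⟩
      by_cases h : (i : ℕ) = j
      · subst h; simp
      · simp [h])

theorem coord_inl (j : ℕ) (p : X) : coord j (inl p : FiniteAdj x A a k) = a j := rfl

theorem coord_inr_self (j : Fin k) (p : A j) : coord j (inr j p : FiniteAdj x A a k) = p := by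
  simp [coord, inr]

theorem coord_inr_of_ne {j : ℕ} {i : Fin k} (h : (i : ℕ) ≠ j) (p : A i) :
    coord j (inr i p : FiniteAdj x A a k) = a j := by
  simp [coord, inr, h]

theorem coord_collapse {j : ℕ} (hj : j < k) (z : FiniteAdj x A a (k + 1)) :
    coord j (collapse x A a k z) = coord j z := by
  induction z using FiniteAdj.induction with
  | inl p => rfl
  | inr i p =>
    by_cases h : (i : ℕ) < k
    · simp [coord, collapse, inr, h]
    · simp [coord, collapse, inr, h, show (i : ℕ) ≠ j by omega]

open Classical in
/-- The point of the `k`-th adjunction space with given coordinates; only meaningful on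
`AdjCoords x A a`. -/
def ofCoords (k : ℕ) (c : X × ∀ j, A j) : FiniteAdj x A a k :=
  if h : ∃ j : Fin k, c.2 j ≠ a j then inr h.choose (c.2 h.choose) else inl c.1

variable {c : X × ∀ j, A j}

theorem ofCoords_of_ne (hc : c ∈ AdjCoords x A a) (j : Fin k) (hj : c.2 j ≠ a j) :
    (ofCoords k c : FiniteAdj x A a k) = inr j (c.2 j) := by
  have h : ∃ j : Fin k, c.2 j ≠ a j := ⟨j, hj⟩
  obtain rfl : h.choose = j := by
    by_contra hne
    exact h.choose_spec ((hc j hj).2 _ fun he => hne (Fin.ext he))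
  rw [ofCoords, dif_pos h]

theorem ofCoords_of_forall_eq (h : ∀ j : Fin k, c.2 j = a j) :
    (ofCoords k c : FiniteAdj x A a k) = inl c.1 :=
  dif_neg fun ⟨j, hj⟩ => hj (h j)

theorem coord_ofCoords (hc : c ∈ AdjCoords x A a) {j : ℕ} (hj : j < k) :
    coord j (ofCoords k c : FiniteAdj x A a k) = c.2 j := by
  by_cases h : ∃ i : Fin k, c.2 i ≠ a i
  · obtain ⟨i, hi⟩ := h
    rw [ofCoords_of_ne hc i hi]
    obtain rfl | hij := eq_or_ne (i : ℕ) j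
    · exact coord_inr_self i _
    · rw [coord_inr_of_ne hij, (hc i hi).2 j hij.symm]
  · push Not at h
    rw [ofCoords_of_forall_eq h, coord_inl, h ⟨j, hj⟩]

theorem ofCoords_mem_iff (hc : c ∈ AdjCoords x A a) {W : Set (FiniteAdj x A a k)} :
    ofCoords k c ∈ W ↔ (∀ j : Fin k, inr j (a j) ∈ W → inr j (c.2 j) ∈ W) ∧
      (inl c.1 ∈ W ∨ ∃ j : Fin k, inr j (a j) ∉ W ∧ inr j (c.2 j) ∈ W) := by
  by_cases h : ∃ i : Fin k, c.2 i ≠ a i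
  · obtain ⟨i, hi⟩ := h
    have hother : ∀ j : Fin k, j ≠ i → c.2 j = a j := fun j hj =>
      (hc i hi).2 j (Fin.val_ne_of_ne hj)
    rw [ofCoords_of_ne hc i hi, (hc i hi).1, ← inr_basepoint]
    refine ⟨fun hW => ⟨fun j hj => ?_, or_iff_not_imp_left.2 fun h => ⟨i, h, hW⟩⟩, ?_⟩
    · obtain rfl | hji := eq_or_ne j i
      exacts [hW, (hother j hji).symm ▸ hj]
    · rintro ⟨hall, hiW | ⟨j, hj, hjW⟩⟩
      · exact hall i hiW
      · obtain rfl | hji := eq_or_ne j i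
        exacts [hjW, absurd (hother j hji ▸ hjW) hj]
  · push Not at h
    simp [ofCoords_of_forall_eq h, h]

variable [TopologicalSpace X] [∀ j, TopologicalSpace (A j)]

theorem toCore_collapse (z : FiniteAdj x A a (k + 1)) :
    toCore x A a k (collapse x A a k z) = toCore x A a (k + 1) z := by
  induction z using FiniteAdj.induction with
  | inl p => rfl
  | inr j p => by_cases h : (j : ℕ) < k <;> simp [collapse, toCore, inr, h]

theorem coords_mem (z : FiniteAdj x A a k) :
    (toCore x A a k z, fun j => coord j z) ∈ AdjCoords x A a := by
  intro j hj
  induction z using FiniteAdj.induction with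
  | inl p => exact (hj rfl).elim
  | inr i p =>
    obtain rfl : (i : ℕ) = j := by_contra fun h => hj (coord_inr_of_ne (x := x) h p)
    exact ⟨rfl, fun l hl => coord_inr_of_ne (x := x) hl.symm p⟩

theorem toCore_ofCoords (hc : c ∈ AdjCoords x A a) : toCore x A a k (ofCoords k c) = c.1 := by
  by_cases h : ∃ i : Fin k, c.2 i ≠ a i
  · obtain ⟨i, hi⟩ := h
    rw [ofCoords_of_ne hc i hi]
    exact (hc i hi).1.symm
  · push Not at h
    rw [ofCoords_of_forall_eq h]
    rfl

theorem ofCoords_eq (hc : c ∈ AdjCoords x A a) {z : FiniteAdj x A a k}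
    (hcore : toCore x A a k z = c.1) (hcoord : ∀ j < k, coord j z = c.2 j) :
    ofCoords k c = z := by
  induction z using FiniteAdj.induction with
  | inl p =>
    rw [ofCoords_of_forall_eq fun j => (hcoord j j.2).symm, ← hcore]
    rfl
  | inr i p =>
    have hi : p = c.2 i := (coord_inr_self i p).symm.trans (hcoord i i.2)
    by_cases hp : c.2 i = a i
    · have hall : ∀ j : Fin k, c.2 j = a j := fun j => by
        obtain rfl | hij := eq_or_ne i j
        · exact hp
        · rw [← hcoord j j.2, coord_inr_of_ne (Fin.val_ne_of_ne hij)]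
      rw [ofCoords_of_forall_eq hall, hi, hp, inr_basepoint, ← hcore]
      rfl
    · rw [ofCoords_of_ne hc i hp, hi]

theorem collapse_ofCoords (hc : c ∈ AdjCoords x A a) :
    collapse x A a k (ofCoords (k + 1) c) = ofCoords k c := by
  refine (ofCoords_eq hc ?_ fun j hj => ?_).symm
  · rw [toCore_collapse, toCore_ofCoords hc]
  · rw [coord_collapse hj, coord_ofCoords hc (hj.trans k.lt_succ_self)]

theorem continuous_inl : Continuous (inl : X → FiniteAdj x A a k) :=
  continuous_quot_mk.comp _root_.continuous_inl

theorem continuous_inr (j : Fin k) : Continuous (inr j : A j → FiniteAdj x A a k) :=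
  continuous_quot_mk.comp (_root_.continuous_inr.comp continuous_sigmaMk)

theorem continuous_coord (j : ℕ) : Continuous (coord j : FiniteAdj x A a k → A j) := by
  refine continuous_quot_lift _ (continuous_const.sumElim (continuous_sigma fun i => ?_))
  obtain rfl | h := eq_or_ne (i : ℕ) j
  · simpa using continuous_id'
  · simpa [h] using continuous_const

theorem continuous_ofCoords (k : ℕ) :
    Continuous fun c : AdjCoords x A a => (ofCoords k c.1 : FiniteAdj x A a k) := by
  refine continuous_def.2 fun W hW => ?_
  have hinl : IsOpen {c : AdjCoords x A a | (inl c.1.1 : FiniteAdj x A a k) ∈ W} :=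
    hW.preimage (continuous_inl.comp (by fun_prop))
  have hinr (j : Fin k) :
      IsOpen {c : AdjCoords x A a | (inr j (c.1.2 j) : FiniteAdj x A a k) ∈ W} :=
    hW.preimage ((continuous_inr j).comp (by fun_prop))
  simp only [Set.preimage, ofCoords_mem_iff (Subtype.prop _), Set.ofPred_and, Set.ofPred_or,
    Set.ofPred_forall, Set.ofPred_exists]
  exact (isOpen_iInter_of_finite fun j => isOpen_iInter_of_finite fun _ => hinr j).inter
    (hinl.union (isOpen_iUnion fun j =>
      (isOpen_iInter_of_finite fun _ => isOpen_const).inter (hinr j)))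

end FiniteAdj

namespace ShrinkingAdj

variable {X : Type*} {x : ℕ → X} {A : ℕ → Type*} {a : ∀ j, A j}

variable [TopologicalSpace X] [∀ j, TopologicalSpace (A j)]

/-- The retraction onto the attached space `A j`, collapsing everything else to `a j`. -/
def coord (j : ℕ) : C(ShrinkingAdj x A a, A j) where
  toFun y := FiniteAdj.coord j (y.1 (j + 1))
  continuous_toFun :=
    (FiniteAdj.continuous_coord j).comp ((continuous_apply (j + 1)).comp continuous_subtype_val)

theorem coord_core (j : ℕ) (p : X) : coord j (core x A a p) = a j := rfl

theorem coord_eq (y : ShrinkingAdj x A a) {j k : ℕ} (h : j < k) :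
    FiniteAdj.coord j (y.1 k) = coord j y := by
  induction k, h using Nat.le_induction with
  | base => rfl
  | succ k hk ih => rw [← ih, ← y.2 k, FiniteAdj.coord_collapse hk]

theorem coords_mem (y : ShrinkingAdj x A a) :
    (retraction x A a y, fun j => coord j y) ∈ AdjCoords x A a := by
  have key : ∀ k, ∀ j < k, coord j y ≠ a j →
      retraction x A a y = x j ∧ ∀ i < k, i ≠ j → coord i y = a i := fun k j hj hy => by
    obtain ⟨h, h'⟩ := FiniteAdj.coords_mem (y.1 k) j ((coord_eq y hj).trans_ne hy)
    exact ⟨(toCore_eq x A a y k).symm.trans h,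
      fun i hi hij => (coord_eq y hi).symm.trans (h' i hij)⟩
  exact fun j hj => ⟨(key (j + 1) j j.lt_succ_self hj).1, fun i hi =>
    (key (max i j + 1) j (by omega) hj).2 i (by omega) hi⟩

variable (x A a) in
/-- Points of a shrinking adjunction space are determined by their coordinates, and the topology is
that of coordinatewise convergence. -/
def coordsHomeomorph : ShrinkingAdj x A a ≃ₜ AdjCoords x A a where
  toFun y := ⟨(retraction x A a y, fun j => coord j y), coords_mem y⟩
  invFun c := ⟨fun k => FiniteAdj.ofCoords k c.1, fun _ => FiniteAdj.collapse_ofCoords c.2⟩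
  left_inv y := Subtype.ext <| funext fun k => FiniteAdj.ofCoords_eq (coords_mem y)
    (toCore_eq x A a y k) fun _ hj => coord_eq y hj
  right_inv c := Subtype.ext <| Prod.ext (FiniteAdj.toCore_ofCoords (k := 0) c.2) <| funext fun j =>
    FiniteAdj.coord_ofCoords c.2 j.lt_succ_self
  continuous_toFun := Continuous.subtype_mk
    ((retraction x A a).continuous.prodMk (continuous_pi fun j => (coord j).continuous)) _
  continuous_invFun := Continuous.subtype_mk (continuous_pi FiniteAdj.continuous_ofCoords) _

end ShrinkingAdj

/-! ### Deformation into the core -/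

namespace ShrinkingAdj

variable {X : Type*} [TopologicalSpace X] {x : ℕ → X} {A : ℕ → Type*}
  [∀ j, TopologicalSpace (A j)] {a : ∀ j, A j}

theorem ext_coords {y z : ShrinkingAdj x A a} (h : retraction x A a y = retraction x A a z)
    (h' : ∀ j, coord j y = coord j z) : y = z :=
  (coordsHomeomorph x A a).injective (Subtype.ext (Prod.ext h (funext h')))

theorem convergesToPoint_iff_coords {K : Type*} [TopologicalSpace K]
    {f : ℕ → C(K, ShrinkingAdj x A a)} {y : ShrinkingAdj x A a} :
    ConvergesToPoint f y ↔
      ConvergesToPoint (fun m => (retraction x A a).comp (f m)) (retraction x A a y) ∧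
        ∀ j, ConvergesToPoint (fun m => (coord j).comp (f m)) (coord j y) := by
  simp only [convergesToPoint_iff_tendsto]
  rw [(coordsHomeomorph x A a).isInducing.tendsto_nhds_iff, tendsto_subtype_rng, Prod.tendsto_iff,
    tendsto_pi_nhds]
  rfl

variable {n : ℕ} {y₀ : X}

theorem sequentiallyHomotopicRel_core (hA : ∀ j, SequentiallyConnectedAt n (A j) (a j))
    (ha : ∀ j, IsClosed {a j}) {K : Type*} [TopologicalSpace K] [CompactSpace K] [T2Space K]
    {e : (Fin n → ℝ) → K} (he : IsOpenEmbedding e) {f : ℕ → C(K, ShrinkingAdj x A a)}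
    (hf : ConvergesToPoint f (core x A a y₀))
    (hfe : ∀ m, ∀ p ∉ Set.range e, f m p ∈ Set.range (core x A a)) :
    SequentiallyHomotopicRel (Set.range e)ᶜ f
      (fun m => ((core x A a).comp (retraction x A a)).comp (f m)) (core x A a y₀) := by
  have hcoord : ∀ j m, ∀ p ∉ Set.range e, coord j (f m p) = a j := fun j m p hp => by
    obtain ⟨q, hq⟩ := hfe m p hp
    rw [← hq, coord_core]
  choose H H0 H1 Ha Hconv using fun j => (hA j).exists_sequential_nullhomotopy_rel (ha j) he
    (hf.postcomp (coord j)) (hcoord j)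
  have hmem : ∀ m (q : I × K),
      (retraction x A a (f m q.2), fun j => H j m q) ∈ AdjCoords x A a := fun m q j hj => by
    obtain ⟨hcore, hother⟩ := coords_mem (f m q.2) j fun h => hj (Ha j m q.1 q.2 h)
    exact ⟨hcore, fun i hi => Ha i m q.1 q.2 (hother i hi)⟩
  let L (m : ℕ) : C(I × K, ShrinkingAdj x A a) :=
    ((coordsHomeomorph x A a).symm : C(AdjCoords x A a, ShrinkingAdj x A a)).comp
      ⟨fun q => ⟨(retraction x A a (f m q.2), fun j => H j m q), hmem m q⟩, by fun_prop⟩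
  have hL : ∀ m q, (retraction x A a (L m q), fun j => coord j (L m q)) =
      (retraction x A a (f m q.2), fun j => H j m q) := fun m q =>
    congrArg Subtype.val ((coordsHomeomorph x A a).apply_symm_apply ⟨_, hmem m q⟩)
  have hLr : ∀ m q, retraction x A a (L m q) = retraction x A a (f m q.2) := fun m q =>
    congrArg Prod.fst (hL m q)
  have hLc : ∀ m q j, coord j (L m q) = H j m q := fun m q => congrFun (congrArg Prod.snd (hL m q))
  refine ⟨hf, hf.postcomp ((core x A a).comp (retraction x A a)), fun m =>
    { toContinuousMap := L m
      map_zero_left := fun p => ext_coords (hLr m _) fun j => (hLc m _ j).trans (H0 j m p)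
      map_one_left := fun p => ext_coords (hLr m _) fun j => (hLc m _ j).trans (H1 j m p)
      prop' := fun s p hp => ext_coords (hLr m _) fun j => (hLc m _ j).trans ?_ },
    convergesToPoint_iff_coords.2 ⟨?_, fun j => ?_⟩⟩
  · exact (Ha j m s p (hcoord j m p hp)).trans (hcoord j m p hp).symm
  · have hLr' : ∀ m, (retraction x A a).comp (L m) =
        ((retraction x A a).comp (f m)).comp ContinuousMap.snd := fun m => ContinuousMap.ext (hLr m)
    exact (funext hLr') ▸ (hf.postcomp (retraction x A a)).precomp ContinuousMap.snd
  · have hLc' : ∀ m, (coord j).comp (L m) = H j m := fun m => ContinuousMap.ext fun q => hLc m q j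
    exact (funext hLc') ▸ Hconv j

end ShrinkingAdj

/-! ### Cubes and spheres as compactifications of `ℝⁿ` -/

theorem isOpenEmbedding_piMap_sigmoid (n : ℕ) :
    IsOpenEmbedding (Pi.map fun _ : Fin n => unitInterval.sigmoid) :=
  IsOpenEmbedding.piMap fun _ =>
    ⟨Topology.isEmbedding_sigmoid, by rw [unitInterval.range_sigmoid]; exact isOpen_Ioo⟩

theorem compl_range_piMap_sigmoid (n : ℕ) :
    (Set.range (Pi.map fun _ : Fin n => unitInterval.sigmoid))ᶜ = Cube.boundary (Fin n) := by
  ext p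
  simp only [Set.range_piMap, unitInterval.range_sigmoid, Set.mem_compl_iff, Set.mem_univ_pi,
    Set.mem_Ioo, Cube.boundary, Set.mem_ofPred_eq, unitInterval.pos_iff_ne_zero,
    unitInterval.lt_one_iff_ne_one]
  push Not
  exact exists_congr fun i => ⟨fun h => or_iff_not_imp_left.2 h, fun h => h.resolve_left⟩

theorem UnitSphere.exists_isOpenEmbedding (k : ℕ) :
    ∃ e : (Fin k → ℝ) → UnitSphere k, IsOpenEmbedding e ∧ Set.range e = {UnitSphere.base k}ᶜ := by
  have : Fact (Module.finrank ℝ (EuclideanSpace ℝ (Fin (k + 1))) = k + 1) := ⟨by simp⟩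
  let s := stereographic' k (UnitSphere.base k)
  have hs : IsOpenEmbedding s.symm := s.symm.isOpenEmbedding (by simp [s])
  refine ⟨s.symm ∘ (EuclideanSpace.equiv (Fin k) ℝ).symm,
    hs.comp (EuclideanSpace.equiv (Fin k) ℝ).symm.toHomeomorph.isOpenEmbedding, ?_⟩
  rw [Set.range_comp, (EuclideanSpace.equiv (Fin k) ℝ).symm.surjective.range_eq]
  simpa [s] using s.symm.image_source_eq_target

/-! ### Loops and Hawaiian earrings in shrinking adjunction spaces -/

theorem homotopyGroup_induced_mul {X Y : Type*} [TopologicalSpace X] [TopologicalSpace Y] {x : X}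
    {y : Y} (h : C(X, Y)) (hxy : h x = y) (m : ℕ) (p q : HomotopyGroup.Pi (m + 1) X x) :
    HomotopyGroup.induced h hxy (m + 1) (p * q) =
      HomotopyGroup.induced h hxy (m + 1) p * HomotopyGroup.induced h hxy (m + 1) q := by
  induction p, q using Quotient.inductionOn₂ with
  | h p q =>
    have hmul := HomotopyGroup.mul_spec (i := (0 : Fin (m + 1))) (p := p) (q := q)
    have hmul' := HomotopyGroup.mul_spec (i := (0 : Fin (m + 1)))
      (p := GenLoop.postcomp h hxy p) (q := GenLoop.postcomp h hxy q)
    refine (congrArg _ hmul).trans (Eq.trans ?_ hmul'.symm)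
    refine congrArg (Quotient.mk _) (GenLoop.ext _ _ fun t => ?_)
    change h (GenLoop.transAt 0 q p t) = _
    simp only [GenLoop.transAt, GenLoop.coe_copy]
    split_ifs <;> rfl

namespace ShrinkingAdj

variable {X : Type*} [TopologicalSpace X] {x : ℕ → X} {A : ℕ → Type*}
  [∀ j, TopologicalSpace (A j)] {a : ∀ j, A j} {n : ℕ} {y₀ : X}

theorem sequentiallyHomotopicRel_core_of_genLoop
    (hA : ∀ j, SequentiallyConnectedAt n (A j) (a j)) (ha : ∀ j, IsClosed {a j})
    (f : ℕ → GenLoop (Fin n) (ShrinkingAdj x A a) (core x A a y₀))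
    (hf : ConvergesToPoint (fun m => (f m).1) (core x A a y₀)) :
    SequentiallyHomotopicRel (Cube.boundary (Fin n)) (fun m => (f m).1)
      (fun m => ((core x A a).comp (retraction x A a)).comp (f m).1) (core x A a y₀) := by
  rw [← compl_range_piMap_sigmoid]
  refine sequentiallyHomotopicRel_core hA ha (isOpenEmbedding_piMap_sigmoid n) hf fun m p hp =>
    ⟨y₀, ((f m).2 p ?_).symm⟩
  rwa [← compl_range_piMap_sigmoid]

theorem sequentiallyConnectedAt_core (hA : ∀ j, SequentiallyConnectedAt n (A j) (a j))
    (ha : ∀ j, IsClosed {a j}) (hX : SequentiallyConnectedAt n X y₀) :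
    SequentiallyConnectedAt n (ShrinkingAdj x A a) (core x A a y₀) := by
  refine sequentiallyConnectedAt_iff.2 fun k hk g hgb hg => ?_
  obtain ⟨e, he, hrange⟩ := UnitSphere.exists_isOpenEmbedding k
  have hcore := sequentiallyHomotopicRel_core (fun j => (hA j).mono hk) ha he hg fun m p hp => by
    rw [hrange, Set.notMem_compl_iff, Set.mem_singleton_iff] at hp
    exact ⟨y₀, hp ▸ (hgb m).symm⟩
  rw [hrange, compl_compl] at hcore
  exact hcore.trans ((sequentiallyConnectedAt_iff.1 hX k hk _
    (fun m => congrArg (retraction x A a) (hgb m)) (hg.postcomp (retraction x A a))).postcomp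
      (core x A a))

theorem homotopicRel_core_of_genLoop (hA : ∀ j, SequentiallyConnectedAt n (A j) (a j))
    (ha : ∀ j, IsClosed {a j}) (f : GenLoop (Fin n) (ShrinkingAdj x A a) (core x A a y₀)) :
    f.1.HomotopicRel (((core x A a).comp (retraction x A a)).comp f.1)
      (Cube.boundary (Fin n)) := by
  let fs : ℕ → GenLoop (Fin n) (ShrinkingAdj x A a) (core x A a y₀) :=
    fun m => Nat.casesOn m f fun _ => GenLoop.const
  have hfs : ConvergesToPoint (fun m => (fs m).1) (core x A a y₀) :=
    convergesToPoint_iff_eventually.2 fun U hU => (eventually_ge_atTop 1).mono fun m hm p => by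
      obtain ⟨m, rfl⟩ := Nat.exists_eq_succ_of_ne_zero (Nat.one_le_iff_ne_zero.1 hm)
      exact mem_of_mem_nhds hU
  exact (sequentiallyHomotopicRel_core_of_genLoop hA ha fs hfs).homotopicRel 0

theorem bijective_induced_retraction (hA : ∀ j, SequentiallyConnectedAt n (A j) (a j))
    (ha : ∀ j, IsClosed {a j}) (y₀ : X) :
    Function.Bijective
      (HomotopyGroup.induced (retraction x A a) (retraction_core x A a y₀) n) := by
  refine Function.bijective_iff_has_inverse.2
    ⟨HomotopyGroup.induced (core x A a) rfl n, fun p => ?_, fun q => ?_⟩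
  · induction p using Quotient.inductionOn with
    | h f => exact Quotient.sound (homotopicRel_core_of_genLoop hA ha f).symm
  · induction q using Quotient.inductionOn with
    | h g => exact congrArg (Quotient.mk _) (GenLoop.ext _ _ fun _ => rfl)

end ShrinkingAdj

end

theorem mainTheorem8_general {X : Type*} [TopologicalSpace X]
    (A : ℕ → Type*) [∀ j, TopologicalSpace (A j)]
    (x : ℕ → X) (a : ∀ j, A j) (ha : ∀ j, IsClosed {a j}) (n : ℕ)
    (hA : ∀ j, SequentiallyConnectedAt n (A j) (a j)) (y₀ : X) :
    (∀ f : ℕ → GenLoop (Fin n) (ShrinkingAdj x A a) (ShrinkingAdj.core x A a y₀),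
      ConvergesToPoint (fun m => (f m).1) (ShrinkingAdj.core x A a y₀) →
      SequentiallyHomotopicRel (Cube.boundary (Fin n))
        (fun m => (f m).1)
        (fun m => ((ShrinkingAdj.core x A a).comp (ShrinkingAdj.retraction x A a)).comp (f m).1)
        (ShrinkingAdj.core x A a y₀)) ∧
    (SequentiallyConnectedAt n X y₀ →
      SequentiallyConnectedAt n (ShrinkingAdj x A a) (ShrinkingAdj.core x A a y₀)) ∧
    (∀ m ≤ n, Function.Bijective
      (HomotopyGroup.induced (ShrinkingAdj.retraction x A a)
        (ShrinkingAdj.retraction_core x A a y₀) m)) ∧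
    (∀ m, m + 1 ≤ n →
      ∃ e : HomotopyGroup.Pi (m + 1) (ShrinkingAdj x A a) (ShrinkingAdj.core x A a y₀) ≃*
          HomotopyGroup.Pi (m + 1) X y₀,
        ⇑e = HomotopyGroup.induced (ShrinkingAdj.retraction x A a)
          (ShrinkingAdj.retraction_core x A a y₀) (m + 1)) := by
  have hbij : ∀ m ≤ n, Function.Bijective (HomotopyGroup.induced (ShrinkingAdj.retraction x A a)
      (ShrinkingAdj.retraction_core x A a y₀) m) := fun m hm =>
    ShrinkingAdj.bijective_induced_retraction (fun j => (hA j).mono hm) ha y₀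
  refine ⟨ShrinkingAdj.sequentiallyHomotopicRel_core_of_genLoop hA ha,
    ShrinkingAdj.sequentiallyConnectedAt_core hA ha, hbij, fun m hm => ?_⟩
  exact ⟨MulEquiv.ofBijective (MonoidHom.mk' _ (homotopyGroup_induced_mul _ _ m)) (hbij _ hm), rfl⟩

theorem mainTheorem8 {X : Type*} [TopologicalSpace X] [T2Space X]
    (A : ℕ → Type*) [∀ j, TopologicalSpace (A j)] [∀ j, T2Space (A j)]
    (x : ℕ → X) (a : ∀ j, A j) (n : ℕ)
    (hA : ∀ j, SequentiallyConnectedAt n (A j) (a j)) (y₀ : X) :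
    (∀ f : ℕ → GenLoop (Fin n) (ShrinkingAdj x A a) (ShrinkingAdj.core x A a y₀),
      ConvergesToPoint (fun m => (f m).1) (ShrinkingAdj.core x A a y₀) →
      SequentiallyHomotopicRel (Cube.boundary (Fin n))
        (fun m => (f m).1)
        (fun m => ((ShrinkingAdj.core x A a).comp (ShrinkingAdj.retraction x A a)).comp (f m).1)
        (ShrinkingAdj.core x A a y₀)) ∧
    (SequentiallyConnectedAt n X y₀ →
      SequentiallyConnectedAt n (ShrinkingAdj x A a) (ShrinkingAdj.core x A a y₀)) ∧
    (∀ m ≤ n, Function.Bijective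
      (HomotopyGroup.induced (ShrinkingAdj.retraction x A a)
        (ShrinkingAdj.retraction_core x A a y₀) m)) ∧
    (∀ m, m + 1 ≤ n →
      ∃ e : HomotopyGroup.Pi (m + 1) (ShrinkingAdj x A a) (ShrinkingAdj.core x A a y₀) ≃*
          HomotopyGroup.Pi (m + 1) X y₀,
        ⇑e = HomotopyGroup.induced (ShrinkingAdj.retraction x A a)
          (ShrinkingAdj.retraction_core x A a y₀) (m + 1)) := by
  exact mainTheorem8_general A x a (fun _ => isClosed_singleton) n hA y₀
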